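/- Let $\mathcal N\subset\mathbb R^3$ be a compact smooth embedded hypersurface with smooth unit normal $\nu$. For a gridsize $h>0$ and $v=(v_j)_{j\in\mathbb Z^2}$ with $v_j\in\mathbb R^3$ put $D_{+i}v_j=(v_{j+e_i}-v_j)/h$, $D_{-i}v_j=(v_j-v_{j-e_i})/h$ for $i=1,2$, and $\Delta^h=\sum_{i=1}^2 D_{+i}D_{-i}$. Let $D^2v_j$ be the vector of all $D^\alpha v_j$ with $|\alpha|=2$, where $\alpha=(\alpha_1^+,\alpha_1^-,\alpha_2^+,\alpha_2^-)\in\mathbb N^4$, $|\alpha|=\sum_i(\alpha_i^++\alpha_i^-)$ and $D^\alpha=\prod_{i=1}^2 (D_{+i})^{\alpha_i^+}(D_{-i})^{\alpha_i^-}$. For $A\subset\mathbb R^2$ put $$E^h[v;A]=\frac12 h^2\sum_{j:\,jh\in A}\ \sum_{i=1}^2\frac12\left(|D_{+i}v_j|^2+|D_{-i}v_j|^2\right),\qquad \|w\|_{L^2_h(A)}=\Big(h^2\sum_{j:\,jh\in A}|w_j|^2\Big)^{1/2},$$ and $E^h[v]=E^h[v;\mathbb R^2]$. A solution of the semi-discrete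 harmonic map heat flow with gridsize $h$ is a family $u^h_j:[0,\infty)\to\mathcal N$, $j\in\mathbb Z^2$, with $$\partial_t u^h_j=\Delta^h u^h_j+\lambda^h_j\,\nu(u^h_j),\qquad \lambda^h_j=-\Delta^h u^h_j\cdot\nu(u^h_j)\qquad(t\ge 0).$$ There is an $\epsilon_0>0$ depending only on $\mathcal N$, and for every $E_0\ge 0$ there is a $\delta>0$ depending only on $\mathcal N$ and $E_0$, such that the following holds. For all $R>0$ and $0<\sigma\le\delta R^2$ there is a constant $C$, depending only on $\mathcal N,E_0,R,\sigma$, such that for every gridsize $h>0$, every solution $u^h$ with $E^h[u^h(0)]\le E_0$, every $t_0\ge 0$ and every $x_0\in\mathbb R^2$ with $$E^h[u^h(t_0);B_R(x_0)]\le\epsilon_0,$$ one has, with $\tau=t_0+\sigma$, $$\sup_{\tau\le t\le t_0+\delta R^2}\|D^2u^h(t)\|_{L^2_h(B_{R/8}(x_0))}\le C .$$ In particular the bound is uniform in $h$. -/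

import Mathlib

open scoped ENNReal NNReal ContDiff Gradient

noncomputable section

namespace DiscreteFlow

/-- The Euclidean plane, the domain of the maps. -/
abbrev Plane := EuclideanSpace ℝ (Fin 2)

/-- Euclidean three-space, the ambient space of the target. -/
abbrev Space := EuclideanSpace ℝ (Fin 3)

/-- Grid indices `j = (j₁, j₂)`. -/
abbrev Grid := Fin 2 → ℤ

/-- The grid point `j h = (j₁ h, j₂ h)` of the plane. -/
def gridPoint (h : ℝ) (j : Grid) : Plane := WithLp.toLp 2 fun i => (j i : ℝ) * h

/-- Forward difference `D₊ᵢ v_j = (v_{j + eᵢ} - v_j) / h`. -/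
def dPlus (h : ℝ) (i : Fin 2) (v : Grid → Space) : Grid → Space :=
  fun j => h⁻¹ • (v (j + Pi.single i 1) - v j)

/-- Backward difference `D₋ᵢ v_j = (v_j - v_{j - eᵢ}) / h`. -/
def dMinus (h : ℝ) (i : Fin 2) (v : Grid → Space) : Grid → Space :=
  fun j => h⁻¹ • (v j - v (j - Pi.single i 1))

/-- The discrete Laplacian `Δʰ = ∑ᵢ D₊ᵢ D₋ᵢ`. -/
def laplacian (h : ℝ) (v : Grid → Space) : Grid → Space :=
  fun j => ∑ i, dPlus h i (dMinus h i v) j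

/-- Multi-indices `α = (α₁⁺, α₂⁺, α₁⁻, α₂⁻)` of order `|α| = k`; `Sum.inl i` is the slot of `D₊ᵢ`
and `Sum.inr i` the slot of `D₋ᵢ`. -/
def multiIndices (k : ℕ) : Finset (Fin 2 ⊕ Fin 2 → ℕ) := Finset.piAntidiag Finset.univ k

/-- The difference operator `D^α = ∏ᵢ (D₊ᵢ)^{αᵢ⁺} (D₋ᵢ)^{αᵢ⁻}`. -/
def diffOp (h : ℝ) (α : Fin 2 ⊕ Fin 2 → ℕ) (v : Grid → Space) : Grid → Space :=
  (dPlus h 0)^[α (Sum.inl 0)] ((dMinus h 0)^[α (Sum.inr 0)]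
    ((dPlus h 1)^[α (Sum.inl 1)] ((dMinus h 1)^[α (Sum.inr 1)] v)))

/-- `D^k v_j`: the vector of all difference derivatives `D^α v_j` with `|α| = k`, with the
Euclidean norm. -/
def diffVec (h : ℝ) (k : ℕ) (v : Grid → Space) (j : Grid) :
    PiLp 2 (fun _ : multiIndices k => Space) :=
  WithLp.toLp 2 fun α => diffOp h α v j

/-- The discrete norm `‖w‖_{L²_h(A)} = (h² ∑_{j : jh ∈ A} |w_j|²)^{1/2}`, with value `∞` if the sum
diverges. -/
def normL2 {V : Type*} [NormedAddCommGroup V] (h : ℝ) (A : Set Plane) (w : Grid → V) : ℝ≥0∞ :=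
  (ENNReal.ofReal (h ^ 2) * ∑' j : (gridPoint h ⁻¹' A : Set Grid),
    ENNReal.ofReal (‖w j‖ ^ 2)) ^ (1 / 2 : ℝ)

/-- The discrete energy over the indices `j` with `jh ∈ A`,
`Eʰ[v; A] = (1/2) h² ∑_{j : jh ∈ A} ∑ᵢ (1/2) (|D₊ᵢ v_j|² + |D₋ᵢ v_j|²)`, with value `∞` if the sum
diverges. -/
def energyOn (h : ℝ) (A : Set Plane) (v : Grid → Space) : ℝ≥0∞ :=
  ENNReal.ofReal (1 / 2 * h ^ 2) * ∑' j : (gridPoint h ⁻¹' A : Set Grid),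
    ENNReal.ofReal (∑ i, 1 / 2 * (‖dPlus h i v j‖ ^ 2 + ‖dMinus h i v j‖ ^ 2))

/-- The total discrete energy `Eʰ[v]`. -/
def energy (h : ℝ) (v : Grid → Space) : ℝ≥0∞ := energyOn h Set.univ v

/-- `N` is a smooth embedded hypersurface (without boundary) of `ℝ³` and `ν` is a smooth unit normal
field on it: near each of its points, `N` is the zero set of a smooth function with nonvanishing
gradient, and `ν` is the normalized gradient of that function along `N`. The values of `ν` off `N`
are irrelevant. -/
def IsHypersurfaceWithNormal (N : Set Space) (ν : Space → Space) : Prop :=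
  ∀ p ∈ N, ∃ (U : Set Space) (F : Space → ℝ), IsOpen U ∧ p ∈ U ∧ ContDiffOn ℝ ∞ F U ∧
    (∀ q ∈ U, ∇ F q ≠ 0) ∧ (∀ q ∈ U, q ∈ N ↔ F q = 0) ∧
    ∀ q ∈ U ∩ N, ν q = ‖∇ F q‖⁻¹ • ∇ F q

/-- The Lagrange multiplier `λ_j = - Δʰ v_j · ν(v_j)`. -/
def multiplier (h : ℝ) (ν : Space → Space) (v : Grid → Space) (j : Grid) : ℝ :=
  -inner ℝ (laplacian h v j) (ν (v j))

/-- `u` (with `u t j = u_j(t)`, `t ≥ 0`) is an `N`-valued solution of the semi-discrete harmonic map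
heat flow `∂ₜ u_j = Δʰ u_j + λ_j ν(u_j)` on the grid of size `h`. Its initial data are `u 0`. The
derivative at time `0` is one-sided. -/
structure IsDiscreteHeatFlow (N : Set Space) (ν : Space → Space) (h : ℝ) (u : ℝ → Grid → Space) :
    Prop where
  mem : ∀ t, 0 ≤ t → ∀ j, u t j ∈ N
  hasDeriv : ∀ t, 0 ≤ t → ∀ j, HasDerivWithinAt (fun s => u s j)
    (laplacian h (u t) j + multiplier h ν (u t) j • ν (u t j)) (Set.Ici 0) t

end DiscreteFlow

end

open DiscreteFlow

/-! In two dimensions the Dirichlet energy is scale invariant, so parabolic rescaling turns the flow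
on the grid of size `h` into a flow on the unit lattice. A disc of radius `R` becomes one of radius
`L = R / h`, and every estimate below has constants independent of `L`; this is the uniformity in
`h`.

The nonlinearity enters through one geometric fact: all `u j` lie on the compact hypersurface, so
the secant to a neighbour is tangential up to a quadratic error (`GeometryBound`). Hence the
multiplier is bounded by the squared discrete gradient (`GeometryBound.abs_unitMultiplier_le`). The
tension, which is the time derivative of the flow, is the tangential part of the Laplacian.

The analysis is Struwe's small-energy regularity argument on a lattice. The discrete Ladyzhenskaya
inequality bounds the fourth power of the gradient by energy times squared second differences. At
small energy this term is absorbed, so second differences are controlled by the tension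
(`IsCutoff.sum_hessSq_le_of_small`). The local energy inequality keeps the energy small up to time
`δ * L ^ 2` and bounds the time integral of the squared tension. Differentiating the equation gives
a differential inequality for the localized tension whose growth rate is again the tension on a
larger disc. A Gronwall argument with the energy in the exponent and the weight `t - t₀` then gives
a bound at positive times without any assumption on the initial tension (`IsUnitFlow.smoothing`).
The elliptic estimate converts it into the bound on second differences. -/

namespace DiscreteFlow

open Filter Topology

/-! ### Quantitative geometry of the target hypersurface -/

/-- Near a point of `N` the normal is the restriction of a `C¹` field, is Lipschitz, and secants are
tangential to second order. -/
theorem IsHypersurfaceWithNormal.exists_local {N : Set Space} {ν : Space → Space}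
    (hν : IsHypersurfaceWithNormal N ν) {p : Space} (hp : p ∈ N) :
    ∃ G : Space → Space, ContDiffAt ℝ 1 G p ∧ (∀ᶠ q in 𝓝 p, q ∈ N → ν q = G q) ∧ ‖ν p‖ = 1 ∧
      ∃ K : ℝ, 0 ≤ K ∧ ∃ V ∈ 𝓝 p, ∀ x ∈ V, ∀ y ∈ V, x ∈ N → y ∈ N →
        |inner ℝ (y - x) (ν x)| ≤ K * ‖y - x‖ ^ 2 ∧ ‖ν y - ν x‖ ≤ K * ‖y - x‖ := by
  obtain ⟨U, F, hU, hpU, hF, hne, hN, hνU⟩ := hν p hp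
  have hUp : U ∈ 𝓝 p := hU.mem_nhds hpU
  have hFp : ContDiffAt ℝ 2 F p := (hF.contDiffAt hUp).of_le ENat.LEInfty.out
  have hd : ContDiffAt ℝ 1 (fderiv ℝ F) p := hFp.fderiv_right (by norm_num)
  have hgr : ContDiffAt ℝ 1 (fun q => ∇ F q) p :=
    ((InnerProductSpace.toDual ℝ Space).symm.contDiff.contDiffAt).comp p hd
  have hnorm : ContDiffAt ℝ 1 (fun q => ‖∇ F q‖⁻¹) p :=
    (hgr.norm ℝ (hne p hpU)).inv (by simpa using hne p hpU)
  have hG : ContDiffAt ℝ 1 (fun q => ‖∇ F q‖⁻¹ • ∇ F q) p := hnorm.smul hgr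
  refine ⟨_, hG, ?_, ?_, ?_⟩
  · filter_upwards [hUp] with q hq hqN using hνU q ⟨hq, hqN⟩
  · rw [hνU p ⟨hpU, hp⟩, norm_smul, norm_inv, norm_norm,
      inv_mul_cancel₀ (by simpa using hne p hpU)]
  obtain ⟨K₁, V₁, hV₁, hL₁⟩ := hG.exists_lipschitzOnWith
  obtain ⟨K₂, V₂, hV₂, hL₂⟩ := hd.exists_lipschitzOnWith
  have hb : ∀ᶠ q in 𝓝 p, ‖∇ F q‖⁻¹ < ‖∇ F p‖⁻¹ + 1 :=
    hnorm.continuousAt.eventually_lt continuousAt_const (lt_add_one _)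
  obtain ⟨ρ, hρ, hball⟩ := Metric.mem_nhds_iff.1
    (inter_mem (inter_mem hUp (inter_mem hV₁ hV₂)) hb)
  have hM : 0 ≤ ‖∇ F p‖⁻¹ + 1 := by positivity
  refine ⟨max ((‖∇ F p‖⁻¹ + 1) * K₂) K₁, le_max_of_le_right K₁.2, Metric.ball p ρ,
    Metric.ball_mem_nhds p hρ, fun x hx y hy hxN hyN => ⟨?_, ?_⟩⟩
  · have hxU : x ∈ U := (hball hx).1.1
    have hkey : ‖F y - F x - fderiv ℝ F x (y - x)‖ ≤ (K₂ * ‖y - x‖) * ‖y - x‖ := by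
      -- Intersecting with the closed ball about `x` bounds the oscillation of `fderiv ℝ F` by `K₂ *
      -- ‖y - x‖`, which makes the Taylor remainder quadratic.
      refine Convex.norm_image_sub_le_of_norm_hasFDerivWithin_le' (f' := fderiv ℝ F)
        (s := Metric.ball p ρ ∩ Metric.closedBall x ‖y - x‖) (fun z hz => ?_) (fun z hz => ?_)
        ((convex_ball p ρ).inter (convex_closedBall x _)) ⟨hx, by simp⟩
        ⟨hy, by simp [dist_eq_norm]⟩
      · have hzU : z ∈ U := (hball hz.1).1.1
        exact (((hF.contDiffAt (hU.mem_nhds hzU)).differentiableAt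
          (by simp)).hasFDerivAt).hasFDerivWithinAt
      · refine (hL₂.norm_sub_le (hball hz.1).1.2.2 (hball hx).1.2.2).trans ?_
        have := hz.2
        rw [Metric.mem_closedBall, dist_eq_norm] at this
        gcongr
    rw [(hN x hxU).1 hxN, (hN y (hball hy).1.1).1 hyN] at hkey
    have h2 : inner ℝ (y - x) (∇ F x) = fderiv ℝ F x (y - x) := by
      rw [real_inner_comm, inner_gradient_left]
    rw [hνU x ⟨hxU, hxN⟩, inner_smul_right, h2, abs_mul, abs_inv, abs_norm]
    have h3 : |fderiv ℝ F x (y - x)| ≤ K₂ * ‖y - x‖ ^ 2 := by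
      rwa [sub_self, zero_sub, norm_neg, Real.norm_eq_abs, mul_assoc, ← pow_two] at hkey
    calc ‖∇ F x‖⁻¹ * |fderiv ℝ F x (y - x)|
        ≤ (‖∇ F p‖⁻¹ + 1) * (K₂ * ‖y - x‖ ^ 2) :=
          mul_le_mul (hball hx).2.le h3 (abs_nonneg _) hM
      _ = (‖∇ F p‖⁻¹ + 1) * K₂ * ‖y - x‖ ^ 2 := by ring
      _ ≤ _ := by gcongr; exact le_max_left _ _
  · rw [hνU x ⟨(hball hx).1.1, hxN⟩, hνU y ⟨(hball hy).1.1, hyN⟩]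
    refine (hL₁.norm_sub_le (hball hy).1.2.1 (hball hx).1.2.1).trans ?_
    gcongr
    exact le_max_right _ _

/-- Quantitative geometry of a compact hypersurface. -/
structure GeometryBound (N : Set Space) (ν : Space → Space) (K : ℝ) : Prop where
  one_le : 1 ≤ K
  norm_le : ∀ p ∈ N, ‖p‖ ≤ K
  norm_normal : ∀ p ∈ N, ‖ν p‖ = 1
  inner_le : ∀ p ∈ N, ∀ q ∈ N, |inner ℝ (q - p) (ν p)| ≤ K * ‖q - p‖ ^ 2
  normal_sub_le : ∀ p ∈ N, ∀ q ∈ N, ‖ν q - ν p‖ ≤ K * ‖q - p‖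

/-- Compactness is applied to `N ×ˢ N`: near the diagonal the local lemma gives both inequalities,
and away from it `‖q - p‖` is bounded below, so the trivial bounds from `‖ν‖ = 1` suffice. -/
theorem IsHypersurfaceWithNormal.exists_geometryBound {N : Set Space} {ν : Space → Space}
    (hN : IsCompact N) (hν : IsHypersurfaceWithNormal N ν) : ∃ K, GeometryBound N ν K := by
  have hone : ∀ p ∈ N, ‖ν p‖ = 1 := fun p hp => by
    obtain ⟨G, -, -, h, -⟩ := hν.exists_local hp
    exact h
  obtain ⟨K₀, hK₀⟩ := hN.isBounded.exists_norm_le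
  have key : ∃ K : ℝ, 0 ≤ K ∧ ∀ z ∈ N ×ˢ N, z.1 ∈ N → z.2 ∈ N →
      |inner ℝ (z.2 - z.1) (ν z.1)| ≤ K * ‖z.2 - z.1‖ ^ 2 ∧
        ‖ν z.2 - ν z.1‖ ≤ K * ‖z.2 - z.1‖ := by
    refine (hN.prod hN).induction_on (p := fun s => ∃ K : ℝ, 0 ≤ K ∧ ∀ z ∈ s, z.1 ∈ N → z.2 ∈ N →
      |inner ℝ (z.2 - z.1) (ν z.1)| ≤ K * ‖z.2 - z.1‖ ^ 2 ∧
        ‖ν z.2 - ν z.1‖ ≤ K * ‖z.2 - z.1‖) ⟨0, le_rfl, by simp⟩ ?_ ?_ ?_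
    · rintro s t hst ⟨K, hK, h⟩
      exact ⟨K, hK, fun z hz => h z (hst hz)⟩
    · rintro s t ⟨K, hK, h⟩ ⟨K', hK', h'⟩
      refine ⟨max K K', le_max_of_le_left hK, fun z hz h1 h2 => ?_⟩
      rcases hz with hz | hz
      · refine ⟨(h z hz h1 h2).1.trans ?_, (h z hz h1 h2).2.trans ?_⟩ <;>
          · gcongr; exact le_max_left _ _
      · refine ⟨(h' z hz h1 h2).1.trans ?_, (h' z hz h1 h2).2.trans ?_⟩ <;>
          · gcongr; exact le_max_right _ _
    · rintro ⟨p, q⟩ ⟨hp, hq⟩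
      by_cases hpq : p = q
      · subst hpq
        obtain ⟨G, -, -, -, K, hK, V, hV, h⟩ := hν.exists_local hp
        exact ⟨V ×ˢ V, mem_nhdsWithin_of_mem_nhds (prod_mem_nhds hV hV), K, hK,
          fun z hz h1 h2 => h _ hz.1 _ hz.2 h1 h2⟩
      · set d : ℝ := ‖q - p‖ / 2 with hd
        have hdpos : 0 < d := by
          have : 0 < ‖q - p‖ := norm_pos_iff.2 (sub_ne_zero.2 (Ne.symm hpq))
          positivity
        have hcont : Continuous fun z : Space × Space => ‖z.2 - z.1‖ := by fun_prop
        refine ⟨{z | d < ‖z.2 - z.1‖}, mem_nhdsWithin_of_mem_nhds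
          ((isOpen_lt continuous_const hcont).mem_nhds ?_), 2 / d, by positivity, ?_⟩
        · simp only [Set.mem_ofPred_eq]; linarith
        · rintro ⟨x, y⟩ hz h1 h2
          simp only [Set.mem_ofPred_eq] at hz h1 h2 ⊢
          have h3 : 1 ≤ ‖y - x‖ / d := (one_le_div hdpos).2 hz.le
          constructor
          · calc |inner ℝ (y - x) (ν x)| ≤ ‖y - x‖ * ‖ν x‖ := abs_real_inner_le_norm _ _
              _ = ‖y - x‖ := by rw [hone x h1, mul_one]
              _ ≤ ‖y - x‖ * (2 * (‖y - x‖ / d)) :=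
                le_mul_of_one_le_right (norm_nonneg _) (by linarith)
              _ = 2 / d * ‖y - x‖ ^ 2 := by ring
          · calc ‖ν y - ν x‖ ≤ ‖ν y‖ + ‖ν x‖ := norm_sub_le _ _
              _ = 2 := by rw [hone x h1, hone y h2]; norm_num
              _ ≤ 2 * (‖y - x‖ / d) := by linarith
              _ = 2 / d * ‖y - x‖ := by ring
  obtain ⟨K, hK, h⟩ := key
  refine ⟨max 1 (max K₀ K), le_max_left _ _, fun p hp => (hK₀ p hp).trans (by simp), hone,
    fun p hp q hq => (h (p, q) ⟨hp, hq⟩ hp hq).1.trans ?_,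
    fun p hp q hq => (h (p, q) ⟨hp, hq⟩ hp hq).2.trans ?_⟩ <;>
  · gcongr; simp

/-- The normal along a differentiable curve in `N` is differentiable. -/
theorem GeometryBound.exists_hasDerivWithinAt_normal {N : Set Space} {ν : Space → Space} {K : ℝ}
    (hK : GeometryBound N ν K) (hν : IsHypersurfaceWithNormal N ν) {γ : ℝ → Space} {w : Space}
    {t : ℝ} (ht : 0 ≤ t) (hγ : ∀ s, 0 ≤ s → γ s ∈ N) (hw : HasDerivWithinAt γ w (Set.Ici 0) t) :
    ∃ m : Space, HasDerivWithinAt (fun s => ν (γ s)) m (Set.Ici 0) t ∧ ‖m‖ ≤ K * ‖w‖ := by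
  obtain ⟨G, hG, hGe, -, -⟩ := hν.exists_local (hγ t ht)
  have h1 : HasDerivWithinAt (fun s => G (γ s)) (fderiv ℝ G (γ t) w) (Set.Ici 0) t :=
    ((hG.differentiableAt (by simp)).hasFDerivAt).comp_hasDerivWithinAt t hw
  have hev : (fun s => ν (γ s)) =ᶠ[𝓝[Set.Ici 0] t] fun s => G (γ s) := by
    filter_upwards [hw.continuousWithinAt.eventually hGe, self_mem_nhdsWithin] with s hs hs0
    exact hs (hγ s hs0)
  have h2 := h1.congr_of_eventuallyEq hev (hev.eq_of_nhdsWithin ht)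
  refine ⟨_, h2, ?_⟩
  -- The norm bound with the global constant `K` comes from passing to the limit in difference
  -- quotients along `N`, where `ν` is `K`-Lipschitz.
  rw [hasDerivWithinAt_iff_tendsto_slope] at h2 hw
  have hbot : (𝓝[Set.Ici 0 \ {t}] t).NeBot := by
    refine NeBot.mono (f := 𝓝[>] t) inferInstance (nhdsWithin_mono _ fun s hs => ⟨?_, ?_⟩)
    · exact ht.trans (le_of_lt hs)
    · exact (ne_of_gt hs)
  refine le_of_tendsto_of_tendsto h2.norm (hw.norm.const_mul K) ?_
  filter_upwards [self_mem_nhdsWithin] with s hs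
  simp only [slope, vsub_eq_sub, norm_smul]
  calc _ ≤ ‖(s - t)⁻¹‖ * (K * ‖γ s - γ t‖) := by
        gcongr; exact hK.normal_sub_le _ (hγ t ht) _ (hγ s hs.1)
    _ = _ := by ring

/-! ### Lattice directions and undivided differences -/

/-- The four lattice directions: `Sum.inl i` is `eᵢ`, `Sum.inr i` is `-eᵢ`. -/
abbrev Dir := Fin 2 ⊕ Fin 2

/-- The lattice vector of a direction. -/
def dir : Dir → Grid := Sum.elim (fun i => Pi.single i 1) (fun i => -Pi.single i 1)

@[simp] theorem dir_swap (a : Dir) : dir a.swap = -dir a := by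
  rcases a with i | i <;> simp [dir]

theorem abs_dir_le (a : Dir) (i : Fin 2) : |dir a i| ≤ 1 := by
  rcases a with k | k <;> by_cases h : i = k <;> simp [dir, h]

section Differences

variable {V : Type*} [AddCommGroup V]

/-- The undivided difference of `v` in the direction `a`. -/
def del (a : Dir) (v : Grid → V) : Grid → V := fun j => v (j + dir a) - v j

theorem del_apply (a : Dir) (v : Grid → V) (j : Grid) : del a v j = v (j + dir a) - v j := rfl

theorem del_comm (a b : Dir) (v : Grid → V) : del a (del b v) = del b (del a v) := by
  funext j
  simp only [del_apply, add_right_comm j (dir a)]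
  abel

theorem del_swap_del (a : Dir) (v : Grid → V) (j : Grid) :
    del a.swap (del a v) j = -(del a v j + del a.swap v j) := by
  simp only [del_apply, dir_swap, neg_add_cancel_right]
  abel

/-- The undivided five-point Laplacian. -/
def lap (v : Grid → V) : Grid → V := fun j => ∑ a, del a v j

theorem sum_del_swap (v : Grid → V) (j : Grid) : ∑ a : Dir, del a.swap v j = lap v j :=
  (Equiv.sumComm (Fin 2) (Fin 2)).sum_comp fun a => del a v j

end Differences

/-- The sum of the squared first differences in all directions. -/
def gradSq {V : Type*} [NormedAddCommGroup V] (v : Grid → V) (j : Grid) : ℝ :=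
  ∑ a, ‖del a v j‖ ^ 2

/-- The sum of the squared second differences in all pairs of directions. -/
def hessSq {V : Type*} [NormedAddCommGroup V] (v : Grid → V) (j : Grid) : ℝ :=
  ∑ a, ∑ b, ‖del a (del b v) j‖ ^ 2

/-- `f` vanishes outside of the points of `S` whose two-step neighbourhood is contained in `S`. -/
def SupportedInside {V : Type*} [Zero V] (S : Finset Grid) (f : Grid → V) : Prop :=
  ∀ j, f j ≠ 0 → ∀ d : Grid, (∀ i, |d i| ≤ 2) → j + d ∈ S

/-! ### Summation by parts and the discrete Sobolev inequality -/

section Summation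

variable {S : Finset Grid}

theorem sum_shift {M : Type*} [AddCommMonoid M] (d : Grid) (g : Grid → M)
    (h : ∀ j, g j ≠ 0 → j ∈ S ∧ j - d ∈ S) : ∑ j ∈ S, g (j + d) = ∑ j ∈ S, g j := by
  rw [← finsum_eq_sum_of_support_subset g fun j hj => (h j hj).1,
    ← finsum_eq_sum_of_support_subset (fun j => g (j + d)) fun j hj => by
      simpa using (h _ hj).2]
  exact finsum_comp_equiv (f := g) (Equiv.addRight d)

/-- Both sides run over oriented edges, and reversing the orientation of every edge is a bijection.
The support condition keeps both endpoints in `S`, so no boundary terms appear. -/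
theorem sum_swap {M : Type*} [AddCommMonoid M] (F : Grid → Grid → M)
    (h : ∀ j a, F j (j + dir a) ≠ 0 → j ∈ S ∧ j + dir a ∈ S) :
    ∑ j ∈ S, ∑ a, F j (j + dir a) = ∑ j ∈ S, ∑ a, F (j + dir a) j := by
  rw [Finset.sum_comm, Finset.sum_comm (s := S),
    ← (Equiv.sumComm (Fin 2) (Fin 2)).sum_comp]
  refine Finset.sum_congr rfl fun a _ => ?_
  have key := sum_shift (S := S) (dir a) (fun j => F j (j - dir a)) fun j hj => by
    have := h j a.swap
    rw [dir_swap, ← sub_eq_add_neg] at this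
    exact this hj
  simp only [add_sub_cancel_right] at key
  rw [key]
  refine Finset.sum_congr rfl fun j _ => ?_
  rw [Equiv.sumComm_apply, dir_swap, sub_eq_add_neg]

theorem SupportedInside.mem {V : Type*} [Zero V] {f : Grid → V} (hf : SupportedInside S f)
    {j : Grid} (hj : f j ≠ 0) : j ∈ S := by
  simpa using hf j hj 0 (by simp)

theorem SupportedInside.add_dir_mem {V : Type*} [Zero V] {f : Grid → V}
    (hf : SupportedInside S f) {j : Grid} (hj : f j ≠ 0) (a : Dir) : j + dir a ∈ S :=
  hf j hj _ fun i => (abs_dir_le a i).trans (by norm_num)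

theorem SupportedInside.sub_dir_mem {V : Type*} [Zero V] {f : Grid → V}
    (hf : SupportedInside S f) {j : Grid} (hj : f j ≠ 0) (a : Dir) : j - dir a ∈ S := by
  simpa [sub_eq_add_neg] using hf.add_dir_mem hj a.swap

theorem SupportedInside.mem_of_add {V : Type*} [Zero V] {f : Grid → V}
    (hf : SupportedInside S f) {j : Grid} {a : Dir} (hj : f (j + dir a) ≠ 0) : j ∈ S := by
  simpa using hf.sub_dir_mem hj a

theorem SupportedInside.del_mem {V : Type*} [AddCommGroup V] {f : Grid → V}
    (hf : SupportedInside S f) {j : Grid} {b : Dir} (hj : del b f j ≠ 0) (a : Dir) :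
    j ∈ S ∧ j - dir a ∈ S := by
  by_cases h0 : f j = 0
  · have h1 : f (j + dir b) ≠ 0 := fun h => hj (by simp [del_apply, h, h0])
    refine ⟨hf.mem_of_add h1, ?_⟩
    have := hf _ h1 (-dir b - dir a) fun i => by
      have h2 := abs_dir_le a i
      have h3 := abs_dir_le b i
      simp only [Pi.sub_apply, Pi.neg_apply]
      rw [abs_le] at *
      omega
    convert this using 1
    abel
  · exact ⟨hf.mem h0, hf.sub_dir_mem h0 a⟩

theorem sum_inner_del (a : Dir) (f g : Grid → Space)
    (h : ∀ j, f j ≠ 0 → j ∈ S ∧ j - dir a ∈ S) :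
    ∑ j ∈ S, inner ℝ (del a f j) (g j) = ∑ j ∈ S, inner ℝ (f j) (del a.swap g j) := by
  have key := sum_shift (S := S) (dir a) (fun j => (inner ℝ (f j) (g (j - dir a)) : ℝ))
    fun j hj => h j fun h0 => hj (by simp [h0])
  simp only [add_sub_cancel_right] at key
  simp only [del_apply, inner_sub_left, inner_sub_right, Finset.sum_sub_distrib, key, dir_swap,
    ← sub_eq_add_neg]

/-- The discrete form of the `L²` identity between Hessian and Laplacian. The adjoint of `del a` is
`del a.swap` and differences commute, so the cross terms assemble into the square of `∑ a, del
a.swap (del a f)`, which is `-2` times the Laplacian. -/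
theorem sum_hessSq_eq {f : Grid → Space} (hf : SupportedInside S f) :
    ∑ j ∈ S, hessSq f j = 4 * ∑ j ∈ S, ‖lap f j‖ ^ 2 := by
  have key : ∀ a b : Dir, ∑ j ∈ S, ‖del a (del b f) j‖ ^ 2 =
      ∑ j ∈ S, inner ℝ (del a.swap (del a f) j) (del b.swap (del b f) j) := fun a b => by
    calc ∑ j ∈ S, ‖del a (del b f) j‖ ^ 2
        = ∑ j ∈ S, inner ℝ (del a (del b f) j) (del a (del b f) j) := by
          simp only [real_inner_self_eq_norm_sq]
      _ = ∑ j ∈ S, inner ℝ (del b f j) (del a.swap (del a (del b f)) j) :=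
          sum_inner_del a _ _ fun j hj => hf.del_mem hj a
      _ = ∑ j ∈ S, inner ℝ (f j) (del b.swap (del a.swap (del a (del b f))) j) :=
          sum_inner_del b _ _ fun j hj => ⟨hf.mem hj, hf.sub_dir_mem hj b⟩
      _ = ∑ j ∈ S, inner ℝ (f j) (del a.swap (del a (del b.swap (del b f))) j) := by
          rw [del_comm b.swap a.swap, del_comm b.swap a]
      _ = ∑ j ∈ S, inner ℝ (del a f j) (del a (del b.swap (del b f)) j) :=
          (sum_inner_del a _ _ fun j hj => ⟨hf.mem hj, hf.sub_dir_mem hj a⟩).symm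
      _ = ∑ j ∈ S, inner ℝ (del a.swap (del a f) j) (del b.swap (del b f) j) := by
          have := sum_inner_del (S := S) a.swap (del a f) (del b.swap (del b f))
            fun j hj => hf.del_mem hj a.swap
          rw [this, Sum.swap_swap]
  have hlap : ∀ j, ∑ a : Dir, del a.swap (del a f) j = (-2 : ℝ) • lap f j := fun j => by
    simp only [del_swap_del, Finset.sum_neg_distrib, Finset.sum_add_distrib, sum_del_swap]
    rw [← lap]
    module
  calc ∑ j ∈ S, hessSq f j = ∑ a, ∑ b, ∑ j ∈ S, ‖del a (del b f) j‖ ^ 2 := by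
        simp only [hessSq]
        rw [Finset.sum_comm]
        exact Finset.sum_congr rfl fun a _ => Finset.sum_comm
    _ = ∑ a : Dir, ∑ b : Dir, ∑ j ∈ S,
          inner ℝ (del a.swap (del a f) j) (del b.swap (del b f) j) := by simp only [key]
    _ = ∑ j ∈ S, inner ℝ (∑ a : Dir, del a.swap (del a f) j)
          (∑ b : Dir, del b.swap (del b f) j) := by
        simp only [sum_inner, inner_sum]
        rw [Finset.sum_comm, Finset.sum_comm (s := S)]
        exact Finset.sum_congr rfl fun a _ => Finset.sum_comm
    _ = 4 * ∑ j ∈ S, ‖lap f j‖ ^ 2 := by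
        simp only [hlap, inner_smul_left, inner_smul_right, real_inner_self_eq_norm_sq,
          Finset.mul_sum]
        exact Finset.sum_congr rfl fun j _ => by simp; ring

theorem abs_le_sum_abs_sub {f : ℤ → ℝ} {I : Finset ℤ} (h : ∀ x, f x ≠ 0 → x ∈ I)
    (h' : ∀ x, f (x + 1) - f x ≠ 0 → x ∈ I) (x : ℤ) :
    |f x| ≤ ∑ k ∈ I, |f (k + 1) - f k| := by
  have hstep : ∀ n : ℕ, |f x| ≤ ∑ k ∈ Finset.Ico x (x + n), |f (k + 1) - f k| + |f (x + n)| := by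
    intro n
    induction n with
    | zero => simp
    | succ n ih =>
      have h1 : Finset.Ico x (x + (n + 1 : ℕ)) = insert (x + n) (Finset.Ico x (x + n)) := by
        ext k
        simp only [Finset.mem_Ico, Finset.mem_insert]
        push_cast
        omega
      rw [h1, Finset.sum_insert (by simp)]
      have h2 : |f (x + n)| ≤ |f (x + n + 1) - f (x + n)| + |f (x + n + 1)| := by
        have := abs_sub_abs_le_abs_sub (f (x + n)) (f (x + n + 1))
        rw [abs_sub_comm] at this
        linarith
      push_cast
      rw [← add_assoc]
      linarith
  obtain ⟨m, hm⟩ := I.bddAbove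
  obtain ⟨n, hn⟩ : ∃ n : ℕ, m < x + n := ⟨(m + 1 - x).toNat, by omega⟩
  have h0 : f (x + n) = 0 := by
    by_contra hne
    exact absurd (hm (h _ hne)) (by omega)
  refine (hstep n).trans ?_
  rw [h0, abs_zero, add_zero]
  rw [← Finset.sum_filter_ne_zero]
  refine Finset.sum_le_sum_of_subset_of_nonneg (fun k hk => ?_) fun _ _ _ => abs_nonneg _
  exact h' k (abs_ne_zero.1 (Finset.mem_filter.1 hk).2)

theorem sum_eq_sum_sum {F : Grid → ℝ} {I : Finset ℤ} (hI : ∀ j ∈ S, ∀ i, j i ∈ I)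
    (hF : ∀ j, F j ≠ 0 → j ∈ S) : ∑ j ∈ S, F j = ∑ x ∈ I, ∑ y ∈ I, F ![x, y] := by
  rw [← Finset.sum_product']
  have h1 : ∑ p ∈ I ×ˢ I, F ![p.1, p.2] =
      ∑ j ∈ (I ×ˢ I).map (finTwoArrowEquiv ℤ).symm.toEmbedding, F j := by
    rw [Finset.sum_map]
    rfl
  rw [h1]
  refine Finset.sum_subset (fun j hj => ?_) fun j _ hj => not_not.1 (mt (hF j) hj)
  rw [Finset.mem_map]
  exact ⟨(j 0, j 1), Finset.mem_product.2 ⟨hI j hj 0, hI j hj 1⟩,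
    (finTwoArrowEquiv ℤ).symm_apply_apply j⟩

/-- The discrete Ladyzhenskaya (Sobolev `W^{1,1} ⊂ L²`) inequality in the plane. -/
theorem sum_sq_le_sum_abs_del {g : Grid → ℝ} (hg : SupportedInside S g) :
    ∑ j ∈ S, g j ^ 2 ≤
      (∑ j ∈ S, |del (Sum.inl 0) g j|) * ∑ j ∈ S, |del (Sum.inl 1) g j| := by
  -- One interval set for both coordinates, so that `I ×ˢ I` contains `S` and the planar sums become
  -- iterated ones.
  set I : Finset ℤ := S.image (fun j => j 0) ∪ S.image (fun j => j 1) with hIdef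
  have hI : ∀ j ∈ S, ∀ i, j i ∈ I := fun j hj i => by
    rw [hIdef, Finset.mem_union, Finset.mem_image, Finset.mem_image]
    fin_cases i
    · exact Or.inl ⟨j, hj, rfl⟩
    · exact Or.inr ⟨j, hj, rfl⟩
  have hdel : ∀ a j, |del a g j| ≠ 0 → j ∈ S := fun a j hj =>
    (hg.del_mem (b := a) (fun h => hj (by rw [h, abs_zero])) a).1
  have e0 : ∀ x y : ℤ, (![x, y] + dir (Sum.inl 0) : Grid) = ![x + 1, y] := fun x y => by
    ext i; fin_cases i <;> simp [dir]
  have e1 : ∀ x y : ℤ, (![x, y] + dir (Sum.inl 1) : Grid) = ![x, y + 1] := fun x y => by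
    ext i; fin_cases i <;> simp [dir]
  rw [sum_eq_sum_sum hI fun j hj => hg.mem (fun h => hj (by rw [h]; simp)),
    sum_eq_sum_sum hI (hdel (Sum.inl 0)), sum_eq_sum_sum hI (hdel (Sum.inl 1)),
    Finset.sum_comm (f := fun x y => |del (Sum.inl 0) g ![x, y]|), mul_comm,
    Finset.sum_mul_sum]
  refine Finset.sum_le_sum fun x _ => Finset.sum_le_sum fun y _ => ?_
  have h0 : |g ![x, y]| ≤ ∑ k ∈ I, |del (Sum.inl 0) g ![k, y]| := by
    simp only [del_apply, e0]
    refine abs_le_sum_abs_sub (f := fun x => g ![x, y]) (fun k hk => hI _ (hg.mem hk) 0)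
      (fun k hk => hI ![k, y] (hdel (Sum.inl 0) _ ?_) 0) x
    rwa [del_apply, e0, abs_ne_zero]
  have h1 : |g ![x, y]| ≤ ∑ k ∈ I, |del (Sum.inl 1) g ![x, k]| := by
    simp only [del_apply, e1]
    refine abs_le_sum_abs_sub (f := fun y => g ![x, y]) (fun k hk => hI _ (hg.mem hk) 1)
      (fun k hk => hI ![x, k] (hdel (Sum.inl 1) _ ?_) 1) y
    rwa [del_apply, e1, abs_ne_zero]
  rw [← sq_abs, pow_two]
  exact mul_le_mul h1 h0 (abs_nonneg _) ((abs_nonneg _).trans h1)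

end Summation

/-! ### Cutoffs, interpolation and the elliptic estimate -/

/-- A cutoff function with values in `[0, 1]`, supported well inside `S`, with first differences
bounded by `κ` and second differences bounded by `κ²`. -/
structure IsCutoff (S : Finset Grid) (κ : ℝ) (ψ : Grid → ℝ) : Prop where
  nonneg : ∀ j, 0 ≤ ψ j
  le_one : ∀ j, ψ j ≤ 1
  abs_del_le : ∀ a j, |del a ψ j| ≤ κ
  abs_del_del_le : ∀ a b j, |del a (del b ψ) j| ≤ κ ^ 2
  supp : SupportedInside S ψ

theorem gradSq_nonneg {V : Type*} [NormedAddCommGroup V] (v : Grid → V) (j : Grid) :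
    0 ≤ gradSq v j := Finset.sum_nonneg fun _ _ => sq_nonneg _

theorem hessSq_nonneg {V : Type*} [NormedAddCommGroup V] (v : Grid → V) (j : Grid) :
    0 ≤ hessSq v j := Finset.sum_nonneg fun _ _ => Finset.sum_nonneg fun _ _ => sq_nonneg _

theorem sq_norm_del_le_gradSq {V : Type*} [NormedAddCommGroup V] (v : Grid → V) (a : Dir)
    (j : Grid) : ‖del a v j‖ ^ 2 ≤ gradSq v j :=
  Finset.single_le_sum (f := fun a => ‖del a v j‖ ^ 2) (fun _ _ => sq_nonneg _) (Finset.mem_univ a)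

theorem sum_abs_sq_le {ι : Type*} (s : Finset ι) (x p q : ι → ℝ) (hp : ∀ i ∈ s, 0 ≤ p i)
    (hq : ∀ i ∈ s, 0 ≤ q i) (h : ∀ i ∈ s, x i ^ 2 ≤ p i * q i) :
    (∑ i ∈ s, |x i|) ^ 2 ≤ (∑ i ∈ s, p i) * ∑ i ∈ s, q i :=
  s.sum_sq_le_sum_mul_sum_of_sq_le_mul hp hq fun i hi => (sq_abs (x i)).trans_le (h i hi)

section Estimates

variable {S : Finset Grid}

/-- The pointwise bound on the differences of the squared norm. -/
theorem abs_del_norm_sq_le {f : Grid → Space} (a : Dir) (j : Grid) :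
    |del a (fun k => ‖f k‖ ^ 2) j| ≤ ‖del a f j‖ * (‖f (j + dir a)‖ + ‖f j‖) := by
  simp only [del_apply]
  have h1 := abs_norm_sub_norm_le (f (j + dir a)) (f j)
  rw [sq_sub_sq, abs_mul, mul_comm, abs_of_nonneg (by positivity : 0 ≤ ‖f (j + dir a)‖ + ‖f j‖)]
  gcongr

/-- The planar `W^{1,1}` inequality applied to `‖f‖ ^ 2`, whose differences are handled by
Cauchy–Schwarz. It is the multiplicative inequality that absorbs the nonlinear term in the evolution
of the tension. -/
theorem sum_norm_pow_four_le {f : Grid → Space} (hf : SupportedInside S f) :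
    ∑ j ∈ S, (‖f j‖ ^ 2) ^ 2 ≤ 4 * (∑ j ∈ S, ‖f j‖ ^ 2) * ∑ j ∈ S, gradSq f j := by
  have hg : SupportedInside S fun k => ‖f k‖ ^ 2 := fun j hj =>
    hf j fun h => hj (by simp [h])
  set X := ∑ j ∈ S, ‖f j‖ ^ 2 with hX
  have h1 : ∀ a, (∑ j ∈ S, |del a (fun k => ‖f k‖ ^ 2) j|) ^ 2 ≤
      (∑ j ∈ S, gradSq f j) * (4 * X) := fun a => by
    refine (sum_abs_sq_le S _ (fun j => gradSq f j)
      (fun j => 2 * (‖f (j + dir a)‖ ^ 2 + ‖f j‖ ^ 2)) (fun _ _ => gradSq_nonneg _ _)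
      (fun _ _ => by positivity) fun j _ => ?_).trans (le_of_eq ?_)
    · rw [← sq_abs]
      calc |del a (fun k => ‖f k‖ ^ 2) j| ^ 2
          ≤ (‖del a f j‖ * (‖f (j + dir a)‖ + ‖f j‖)) ^ 2 := by
            gcongr; exact abs_del_norm_sq_le a j
        _ = ‖del a f j‖ ^ 2 * (‖f (j + dir a)‖ + ‖f j‖) ^ 2 := mul_pow _ _ _
        _ ≤ _ := by
          gcongr
          · exact gradSq_nonneg _ _
          · exact sq_norm_del_le_gradSq _ _ _
          · exact add_sq_le
    · have := sum_shift (S := S) (dir a) (fun k => ‖f k‖ ^ 2) fun j hj =>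
        ⟨hg.mem hj, hg.sub_dir_mem hj a⟩
      rw [← Finset.mul_sum, Finset.sum_add_distrib, this]
      ring
  have h2 := sum_sq_le_sum_abs_del hg
  have h3 := h1 (Sum.inl 0)
  have h4 := h1 (Sum.inl 1)
  nlinarith [two_mul_le_add_sq (∑ j ∈ S, |del (Sum.inl 0) (fun k => ‖f k‖ ^ 2) j|)
    (∑ j ∈ S, |del (Sum.inl 1) (fun k => ‖f k‖ ^ 2) j|)]

theorem sq_del_gradSq_le (u : Grid → Space) (a : Dir) (j : Grid) :
    (del a (gradSq u) j) ^ 2 ≤ hessSq u j * (2 * (gradSq u (j + dir a) + gradSq u j)) := by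
  have h1 : |del a (gradSq u) j| ≤
      ∑ b, ‖del a (del b u) j‖ * (‖del b u (j + dir a)‖ + ‖del b u j‖) := by
    have h2 : del a (gradSq u) j = ∑ b, del a (fun k => ‖del b u k‖ ^ 2) j := by
      simp only [del_apply, gradSq, Finset.sum_sub_distrib]
    rw [h2]
    exact (Finset.abs_sum_le_sum_abs _ _).trans
      (Finset.sum_le_sum fun b _ => abs_del_norm_sq_le a j)
  have h0 : (0 : ℝ) ≤ |del a (gradSq u) j| := abs_nonneg _
  rw [← sq_abs]
  calc |del a (gradSq u) j| ^ 2
      ≤ (∑ b, ‖del a (del b u) j‖ * (‖del b u (j + dir a)‖ + ‖del b u j‖)) ^ 2 := by gcongr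
    _ ≤ (∑ b, ‖del a (del b u) j‖ ^ 2) * ∑ b, (‖del b u (j + dir a)‖ + ‖del b u j‖) ^ 2 :=
        Finset.sum_mul_sq_le_sq_mul_sq _ _ _
    _ ≤ _ := by
        gcongr
        · exact hessSq_nonneg _ _
        · exact Finset.single_le_sum (f := fun a => ∑ b, ‖del a (del b u) j‖ ^ 2)
            (fun _ _ => Finset.sum_nonneg fun _ _ => sq_nonneg _) (Finset.mem_univ a)
        · rw [gradSq, gradSq, ← Finset.sum_add_distrib, Finset.mul_sum]
          exact Finset.sum_le_sum fun b _ => add_sq_le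

/-- The localized discrete Ladyzhenskaya inequality for the gradient. -/
theorem sum_cutoff_gradSq_sq_le {κ ε : ℝ} {ψ : Grid → ℝ} {u : Grid → Space}
    (hψ : IsCutoff S κ ψ) (hκ : 0 ≤ κ)
    (hu : ∀ d : Grid, (∀ i, |d i| ≤ 1) → ∑ j ∈ S, gradSq u (j + d) ≤ ε) :
    ∑ j ∈ S, ψ j ^ 2 * gradSq u j ^ 2 ≤
      8 * ε * ∑ j ∈ S, ψ j ^ 2 * hessSq u j + 2 * κ ^ 2 * ε ^ 2 := by
  set P := ∑ j ∈ S, ψ j ^ 2 * hessSq u j with hP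
  have hP0 : 0 ≤ P := Finset.sum_nonneg fun j _ => mul_nonneg (sq_nonneg _) (hessSq_nonneg _ _)
  have hε : 0 ≤ ε := (Finset.sum_nonneg fun j _ => gradSq_nonneg u _).trans (hu 0 (by simp))
  have hu0 : ∑ j ∈ S, gradSq u j ≤ ε := by simpa using hu 0 (by simp)
  have hg : SupportedInside S fun k => ψ k * gradSq u k := fun j hj =>
    hψ.supp j fun h => hj (by simp [h])
  have h1 : ∀ a, (∑ j ∈ S, |del a (fun k => ψ k * gradSq u k) j|) ^ 2 ≤
      8 * ε * P + 2 * κ ^ 2 * ε ^ 2 := fun a => by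
    have hua := hu (dir a) (abs_dir_le a)
    have h2 : (∑ j ∈ S, |ψ j * del a (gradSq u) j|) ^ 2 ≤ P * (4 * ε) := by
      refine (sum_abs_sq_le S _ (fun j => ψ j ^ 2 * hessSq u j)
        (fun j => 2 * (gradSq u (j + dir a) + gradSq u j))
        (fun j _ => mul_nonneg (sq_nonneg _) (hessSq_nonneg _ _))
        (fun j _ => mul_nonneg zero_le_two (add_nonneg (gradSq_nonneg _ _) (gradSq_nonneg _ _)))
        fun j _ => ?_).trans ?_
      · rw [mul_pow, mul_assoc]
        gcongr
        exact sq_del_gradSq_le u a j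
      · gcongr
        rw [← Finset.mul_sum, Finset.sum_add_distrib]
        linarith
    have h3 : ∑ j ∈ S, |del a (fun k => ψ k * gradSq u k) j| ≤
        ∑ j ∈ S, |ψ j * del a (gradSq u) j| + κ * ε := by
      calc ∑ j ∈ S, |del a (fun k => ψ k * gradSq u k) j|
          ≤ ∑ j ∈ S, (|ψ j * del a (gradSq u) j| + κ * gradSq u (j + dir a)) := by
            refine Finset.sum_le_sum fun j _ => ?_
            -- In this product rule the difference of `ψ` multiplies the gradient at the shifted
            -- point, without a cutoff; hence the smallness assumption on shifted sums.
            have h4 : del a (fun k => ψ k * gradSq u k) j =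
                ψ j * del a (gradSq u) j + del a ψ j * gradSq u (j + dir a) := by
              simp only [del_apply]; ring
            rw [h4]
            refine (abs_add_le _ _).trans ?_
            rw [abs_mul (del a ψ j), abs_of_nonneg (gradSq_nonneg u _)]
            gcongr
            · exact gradSq_nonneg _ _
            · exact hψ.abs_del_le a j
        _ ≤ _ := by
            rw [Finset.sum_add_distrib, ← Finset.mul_sum]
            gcongr
    have h5 : 0 ≤ ∑ j ∈ S, |del a (fun k => ψ k * gradSq u k) j| :=
      Finset.sum_nonneg fun _ _ => abs_nonneg _
    calc _ ≤ (∑ j ∈ S, |ψ j * del a (gradSq u) j| + κ * ε) ^ 2 := by gcongr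
      _ ≤ 2 * ((∑ j ∈ S, |ψ j * del a (gradSq u) j|) ^ 2 + (κ * ε) ^ 2) := add_sq_le
      _ ≤ _ := by linarith [mul_pow κ ε 2]
  have h2 := sum_sq_le_sum_abs_del hg
  simp only [mul_pow] at h2
  have h3 := h1 (Sum.inl 0)
  have h4 := h1 (Sum.inl 1)
  nlinarith [two_mul_le_add_sq (∑ j ∈ S, |del (Sum.inl 0) (fun k => ψ k * gradSq u k) j|)
    (∑ j ∈ S, |del (Sum.inl 1) (fun k => ψ k * gradSq u k) j|)]

/-- Opposite directions pair up, so the sum of first differences is really of second order and is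
bounded by `κ ^ 2` instead of `κ`. -/
theorem IsCutoff.abs_lap_le {κ : ℝ} {ψ : Grid → ℝ} (hψ : IsCutoff S κ ψ) (j : Grid) :
    |lap ψ j| ≤ 2 * κ ^ 2 := by
  have h1 : ∑ a : Dir, del a.swap (del a ψ) j = -2 * lap ψ j := by
    simp only [del_swap_del, Finset.sum_neg_distrib, Finset.sum_add_distrib, sum_del_swap]
    rw [← lap]
    ring
  have h2 : |∑ a : Dir, del a.swap (del a ψ) j| ≤ 4 * κ ^ 2 := by
    refine (Finset.abs_sum_le_sum_abs _ _).trans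
      ((Finset.sum_le_sum fun a _ => hψ.abs_del_del_le a.swap a j).trans ?_)
    simp
  rw [h1, abs_mul] at h2
  norm_num at h2
  linarith

theorem IsCutoff.sq_norm_lap_smul_le {κ K : ℝ} {ψ : Grid → ℝ} {u : Grid → Space}
    (hψ : IsCutoff S κ ψ) (hK : ∀ j, ‖u j‖ ≤ K) (j : Grid) :
    ‖lap (fun k => ψ k • u k) j‖ ^ 2 ≤
      3 * (ψ j ^ 2 * ‖lap u j‖ ^ 2) + 12 * κ ^ 2 * gradSq u j + 12 * κ ^ 4 * K ^ 2 := by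
  have h1 : lap (fun k => ψ k • u k) j =
      ψ j • lap u j + ∑ a, del a ψ j • del a u j + lap ψ j • u j := by
    simp only [lap, Finset.smul_sum, Finset.sum_smul, ← Finset.sum_add_distrib]
    refine Finset.sum_congr rfl fun a _ => ?_
    simp only [del_apply]
    module
  have hX : ‖ψ j • lap u j‖ ^ 2 = ψ j ^ 2 * ‖lap u j‖ ^ 2 := by
    rw [norm_smul, mul_pow, Real.norm_eq_abs, sq_abs]
  have hY : ‖∑ a, del a ψ j • del a u j‖ ^ 2 ≤ 4 * κ ^ 2 * gradSq u j := by
    have : ‖∑ a, del a ψ j • del a u j‖ ≤ ∑ a, κ * ‖del a u j‖ :=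
      (norm_sum_le _ _).trans (Finset.sum_le_sum fun a _ => by
        rw [norm_smul]
        gcongr
        exact hψ.abs_del_le a j)
    calc _ ≤ (∑ a, κ * ‖del a u j‖) ^ 2 := by gcongr
      _ ≤ (∑ _a : Dir, κ ^ 2) * ∑ a, ‖del a u j‖ ^ 2 := Finset.sum_mul_sq_le_sq_mul_sq _ _ _
      _ = _ := by simp [gradSq]
  have hZ : ‖lap ψ j • u j‖ ^ 2 ≤ 4 * κ ^ 4 * K ^ 2 := by
    rw [norm_smul, mul_pow, Real.norm_eq_abs]
    calc |lap ψ j| ^ 2 * ‖u j‖ ^ 2 ≤ (2 * κ ^ 2) ^ 2 * K ^ 2 := by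
          gcongr
          · exact hψ.abs_lap_le j
          · exact hK j
      _ = _ := by ring
  rw [h1]
  have hn := norm_add₃_le (a := ψ j • lap u j) (b := ∑ a, del a ψ j • del a u j)
    (c := lap ψ j • u j)
  set x := ‖ψ j • lap u j‖
  set y := ‖∑ a, del a ψ j • del a u j‖
  set z := ‖lap ψ j • u j‖
  have h3 : ‖ψ j • lap u j + ∑ a, del a ψ j • del a u j + lap ψ j • u j‖ ^ 2 ≤
      (x + y + z) ^ 2 := by gcongr
  nlinarith [sq_nonneg (x - y), sq_nonneg (y - z), sq_nonneg (x - z)]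

theorem IsCutoff.sq_norm_del_del_le {κ K : ℝ} {ψ : Grid → ℝ} {u : Grid → Space}
    (hψ : IsCutoff S κ ψ) (hκ : 0 ≤ κ) (hK : ∀ j, ‖u j‖ ≤ K) (a b : Dir) (j : Grid) :
    ψ j ^ 2 * ‖del a (del b u) j‖ ^ 2 ≤ 2 * ‖del a (del b fun k => ψ k • u k) j‖ ^ 2 +
      56 * κ ^ 2 * (‖del b u (j + dir a)‖ ^ 2 + ‖del a u j‖ ^ 2 + ‖del b u j‖ ^ 2) +
      4 * κ ^ 4 * K ^ 2 := by
  -- The commutator is expressed through increments from `j`: the increment to the far corner `j +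
  -- dir a + dir b` splits into a step by `a` and a step by `b`. This produces the product of sums.
  have h1 : ψ j • del a (del b u) j = del a (del b fun k => ψ k • u k) j -
      ((del b ψ (j + dir a) + del a ψ j) • (del b u (j + dir a) + del a u j) -
        del a ψ j • del a u j - del b ψ j • del b u j + del a (del b ψ) j • u j) := by
    simp only [del_apply]
    module
  have h2 : ‖(del b ψ (j + dir a) + del a ψ j) • (del b u (j + dir a) + del a u j) -
        del a ψ j • del a u j - del b ψ j • del b u j + del a (del b ψ) j • u j‖ ≤
      κ * (2 * ‖del b u (j + dir a)‖ + 3 * ‖del a u j‖ + ‖del b u j‖) + κ ^ 2 * K := by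
    have e1 : ‖(del b ψ (j + dir a) + del a ψ j) • (del b u (j + dir a) + del a u j)‖ ≤
        (κ + κ) * (‖del b u (j + dir a)‖ + ‖del a u j‖) := by
      rw [norm_smul]
      gcongr
      · exact (abs_add_le _ _).trans (add_le_add (hψ.abs_del_le _ _) (hψ.abs_del_le _ _))
      · exact norm_add_le _ _
    have e2 : ‖del a ψ j • del a u j‖ ≤ κ * ‖del a u j‖ := by
      rw [norm_smul]; gcongr; exact hψ.abs_del_le _ _
    have e3 : ‖del b ψ j • del b u j‖ ≤ κ * ‖del b u j‖ := by
      rw [norm_smul]; gcongr; exact hψ.abs_del_le _ _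
    have e4 : ‖del a (del b ψ) j • u j‖ ≤ κ ^ 2 * K := by
      rw [norm_smul]; gcongr
      · exact hψ.abs_del_del_le _ _ _
      · exact hK j
    refine (norm_add_le _ _).trans ?_
    have := norm_sub_le ((del b ψ (j + dir a) + del a ψ j) • (del b u (j + dir a) + del a u j) -
        del a ψ j • del a u j) (del b ψ j • del b u j)
    have := norm_sub_le ((del b ψ (j + dir a) + del a ψ j) • (del b u (j + dir a) + del a u j))
        (del a ψ j • del a u j)
    linarith
  have h3 : ψ j ^ 2 * ‖del a (del b u) j‖ ^ 2 = ‖ψ j • del a (del b u) j‖ ^ 2 := by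
    rw [norm_smul, mul_pow, Real.norm_eq_abs, sq_abs]
  rw [h3, h1]
  set f := del a (del b fun k => ψ k • u k) j
  set e := (del b ψ (j + dir a) + del a ψ j) • (del b u (j + dir a) + del a u j) -
        del a ψ j • del a u j - del b ψ j • del b u j + del a (del b ψ) j • u j
  set x := ‖del b u (j + dir a)‖
  set y := ‖del a u j‖
  set z := ‖del b u j‖
  have h4 : ‖f - e‖ ^ 2 ≤ 2 * (‖f‖ ^ 2 + ‖e‖ ^ 2) :=
    (pow_le_pow_left₀ (norm_nonneg _) (norm_sub_le _ _) 2).trans add_sq_le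
  have h5 : ‖e‖ ^ 2 ≤ 2 * ((κ * (2 * x + 3 * y + z)) ^ 2 + (κ ^ 2 * K) ^ 2) :=
    (pow_le_pow_left₀ (norm_nonneg _) h2 2).trans add_sq_le
  have h6 : (κ * (2 * x + 3 * y + z)) ^ 2 ≤ κ ^ 2 * (14 * (x ^ 2 + y ^ 2 + z ^ 2)) := by
    rw [mul_pow]
    gcongr
    -- Cauchy–Schwarz with coefficients `2, 3, 1`, whose squares add up to `14`.
    nlinarith [sq_nonneg (3 * x - 2 * y), sq_nonneg (x - 2 * z), sq_nonneg (y - 3 * z)]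
  linarith [mul_pow (κ ^ 2) K 2]

/-- The Hessian identity is applied to the compactly supported `ψ • u`, and the commutators on both
sides are lower order. The zeroth-order error `κ ^ 4 * K ^ 2` per point sums to `κ ^ 2` times a
constant because `κ ^ 2 * S.card` is bounded. -/
theorem IsCutoff.sum_hessSq_le {κ K B ε : ℝ} {ψ : Grid → ℝ} {u : Grid → Space}
    (hψ : IsCutoff S κ ψ) (hκ : 0 ≤ κ) (hK : ∀ j, ‖u j‖ ≤ K) (hB : κ ^ 2 * S.card ≤ B)
    (hu : ∀ d : Grid, (∀ i, |d i| ≤ 1) → ∑ j ∈ S, gradSq u (j + d) ≤ ε) :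
    ∑ j ∈ S, ψ j ^ 2 * hessSq u j ≤ 24 * ∑ j ∈ S, ψ j ^ 2 * ‖lap u j‖ ^ 2 +
      κ ^ 2 * (768 * ε + 160 * K ^ 2 * B) := by
  have hu0 : ∑ j ∈ S, gradSq u j ≤ ε := by simpa using hu 0 (by simp)
  have hf : SupportedInside S fun k => ψ k • u k := fun j hj =>
    hψ.supp j fun h => hj (by simp [h])
  have h1 : ∀ j, ψ j ^ 2 * hessSq u j ≤ 2 * hessSq (fun k => ψ k • u k) j +
      56 * κ ^ 2 * (∑ a, gradSq u (j + dir a) + 8 * gradSq u j) + 64 * (κ ^ 4 * K ^ 2) := fun j => by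
    calc ψ j ^ 2 * hessSq u j = ∑ a, ∑ b, ψ j ^ 2 * ‖del a (del b u) j‖ ^ 2 := by
          simp only [hessSq, Finset.mul_sum]
      _ ≤ ∑ a, ∑ b, (2 * ‖del a (del b fun k => ψ k • u k) j‖ ^ 2 +
            56 * κ ^ 2 * (‖del b u (j + dir a)‖ ^ 2 + ‖del a u j‖ ^ 2 + ‖del b u j‖ ^ 2) +
            4 * κ ^ 4 * K ^ 2) :=
          Finset.sum_le_sum fun a _ => Finset.sum_le_sum fun b _ =>
            hψ.sq_norm_del_del_le hκ hK a b j
      _ = _ := by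
          simp only [Finset.sum_add_distrib, ← Finset.mul_sum, hessSq, gradSq,
            Finset.sum_const, Finset.card_univ, Fintype.card_sum, Fintype.card_fin, nsmul_eq_mul]
          push_cast
          ring
  have h2 : ∑ j ∈ S, ∑ a, gradSq u (j + dir a) ≤ 4 * ε := by
    rw [Finset.sum_comm]
    refine (Finset.sum_le_sum fun a _ => hu (dir a) (abs_dir_le a)).trans (le_of_eq ?_)
    simp
  have h3 : ∑ j ∈ S, ψ j ^ 2 * hessSq u j ≤ 8 * ∑ j ∈ S, ‖lap (fun k => ψ k • u k) j‖ ^ 2 +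
      56 * κ ^ 2 * (12 * ε) + 64 * K ^ 2 * κ ^ 2 * (κ ^ 2 * S.card) := by
    refine (Finset.sum_le_sum fun j _ => h1 j).trans ?_
    simp only [Finset.sum_add_distrib, ← Finset.mul_sum, sum_hessSq_eq hf, Finset.sum_const,
      nsmul_eq_mul]
    have : 56 * κ ^ 2 * (∑ j ∈ S, ∑ a, gradSq u (j + dir a) + 8 * ∑ j ∈ S, gradSq u j) ≤
        56 * κ ^ 2 * (12 * ε) := by gcongr; linarith
    linarith
  have h4 : ∑ j ∈ S, ‖lap (fun k => ψ k • u k) j‖ ^ 2 ≤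
      3 * ∑ j ∈ S, ψ j ^ 2 * ‖lap u j‖ ^ 2 + 12 * κ ^ 2 * ε +
        12 * K ^ 2 * κ ^ 2 * (κ ^ 2 * S.card) := by
    refine (Finset.sum_le_sum fun j _ => hψ.sq_norm_lap_smul_le hK j).trans ?_
    simp only [Finset.sum_add_distrib, ← Finset.mul_sum, Finset.sum_const, nsmul_eq_mul]
    have : 12 * κ ^ 2 * ∑ j ∈ S, gradSq u j ≤ 12 * κ ^ 2 * ε := by gcongr
    linarith
  have h5 : K ^ 2 * κ ^ 2 * (κ ^ 2 * S.card) ≤ K ^ 2 * κ ^ 2 * B := by gcongr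
  linarith

/-- The elliptic estimate: on a region of small energy the second differences and the fourth power
of the gradient are controlled by the tension `W`. -/
theorem IsCutoff.sum_hessSq_le_of_small {κ K B ε : ℝ} {ψ W : Grid → ℝ} {u : Grid → Space}
    (hψ : IsCutoff S κ ψ) (hκ : 0 ≤ κ) (hK1 : 1 ≤ K) (hK : ∀ j, ‖u j‖ ≤ K)
    (hB : κ ^ 2 * S.card ≤ B) (hε : 384 * K ^ 2 * ε ≤ 1)
    (hu : ∀ d : Grid, (∀ i, |d i| ≤ 1) → ∑ j ∈ S, gradSq u (j + d) ≤ ε)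
    (hW : ∀ j, ‖lap u j‖ ^ 2 ≤ W j + K ^ 2 * gradSq u j ^ 2) :
    ∑ j ∈ S, ψ j ^ 2 * hessSq u j ≤
        48 * ∑ j ∈ S, ψ j ^ 2 * W j + κ ^ 2 * (1700 + 320 * K ^ 2 * B) ∧
      ∑ j ∈ S, ψ j ^ 2 * gradSq u j ^ 2 ≤
        48 * ∑ j ∈ S, ψ j ^ 2 * W j + κ ^ 2 * (1700 + 320 * K ^ 2 * B) := by
  have h1 := hψ.sum_hessSq_le hκ hK hB hu
  have h2 := sum_cutoff_gradSq_sq_le hψ hκ hu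
  have h3 : ∑ j ∈ S, ψ j ^ 2 * ‖lap u j‖ ^ 2 ≤
      ∑ j ∈ S, ψ j ^ 2 * W j + K ^ 2 * ∑ j ∈ S, ψ j ^ 2 * gradSq u j ^ 2 := by
    rw [Finset.mul_sum, ← Finset.sum_add_distrib]
    refine Finset.sum_le_sum fun j _ => ?_
    have := mul_le_mul_of_nonneg_left (hW j) (sq_nonneg (ψ j))
    linarith
  set P := ∑ j ∈ S, ψ j ^ 2 * hessSq u j
  set G := ∑ j ∈ S, ψ j ^ 2 * gradSq u j ^ 2
  set Y := ∑ j ∈ S, ψ j ^ 2 * W j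
  have hP0 : 0 ≤ P := Finset.sum_nonneg fun j _ => mul_nonneg (sq_nonneg _) (hessSq_nonneg _ _)
  have hε0 : 0 ≤ ε := (Finset.sum_nonneg fun j _ => gradSq_nonneg u _).trans (hu 0 (by simp))
  have hKsq : 1 ≤ K ^ 2 := one_le_pow₀ hK1
  have hε1 : 384 * ε ≤ 1 := by nlinarith
  have h4 : K ^ 2 * G ≤ K ^ 2 * (8 * ε * P + 2 * κ ^ 2 * ε ^ 2) := by gcongr
  have h5 : 8 * 24 * (K ^ 2 * ε * P) ≤ P / 2 := by nlinarith
  have h6 : K ^ 2 * (κ ^ 2 * ε ^ 2) ≤ κ ^ 2 := by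
    have : K ^ 2 * ε * ε ≤ 1 := by nlinarith
    nlinarith [sq_nonneg κ]
  have h7 : κ ^ 2 * ε ≤ κ ^ 2 := mul_le_of_le_one_right (sq_nonneg _) (by linarith)
  have hP : P ≤ 48 * Y + κ ^ 2 * (1632 + 320 * K ^ 2 * B) := by linarith
  have h8 : 8 * ε * P ≤ P := by nlinarith
  have h9 : κ ^ 2 * ε ^ 2 ≤ κ ^ 2 :=
    mul_le_of_le_one_right (sq_nonneg _) (pow_le_one₀ hε0 (by linarith))
  constructor <;> linarith [sq_nonneg κ]

end Estimates

/-! ### The flow on the unit lattice: pointwise identities -/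

/-- The Lagrange multiplier on the unit lattice. -/
noncomputable def unitMultiplier (ν : Space → Space) (v : Grid → Space) (j : Grid) : ℝ :=
  -inner ℝ (lap v j) (ν (v j))

/-- The tension `Δv + λν`, the right-hand side of the flow on the unit lattice. -/
noncomputable def tension (ν : Space → Space) (v : Grid → Space) (j : Grid) : Space :=
  lap v j + unitMultiplier ν v j • ν (v j)

/-- A solution of the semi-discrete harmonic map heat flow on the unit lattice. -/
structure IsUnitFlow (N : Set Space) (ν : Space → Space) (u : ℝ → Grid → Space) : Prop where
  mem : ∀ t, 0 ≤ t → ∀ j, u t j ∈ N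
  hasDeriv : ∀ t, 0 ≤ t → ∀ j,
    HasDerivWithinAt (fun s => u s j) (tension ν (u t) j) (Set.Ici 0) t

section Pointwise

variable {N : Set Space} {ν : Space → Space} {K : ℝ} {v : Grid → Space}

/-- The Laplacian is a sum of secants of `N` issuing from `v j`, and each has a quadratically small
normal component. -/
theorem GeometryBound.abs_unitMultiplier_le (hK : GeometryBound N ν K) (hv : ∀ j, v j ∈ N)
    (j : Grid) : |unitMultiplier ν v j| ≤ K * gradSq v j := by
  rw [unitMultiplier, abs_neg, lap, sum_inner, gradSq, Finset.mul_sum]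
  exact (Finset.abs_sum_le_sum_abs _ _).trans
    (Finset.sum_le_sum fun a _ => hK.inner_le _ (hv j) _ (hv _))

theorem GeometryBound.inner_tension_normal (hK : GeometryBound N ν K) (hv : ∀ j, v j ∈ N)
    (j : Grid) : inner ℝ (tension ν v j) (ν (v j)) = 0 := by
  rw [tension, inner_add_left, inner_smul_left, real_inner_self_eq_norm_sq,
    hK.norm_normal _ (hv j), unitMultiplier]
  simp

theorem lap_eq_tension_sub (ν : Space → Space) (v : Grid → Space) (j : Grid) :
    lap v j = tension ν v j - unitMultiplier ν v j • ν (v j) := by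
  rw [tension]; abel

theorem GeometryBound.inner_lap_tension (hK : GeometryBound N ν K) (hv : ∀ j, v j ∈ N)
    (j : Grid) : inner ℝ (lap v j) (tension ν v j) = ‖tension ν v j‖ ^ 2 := by
  rw [lap_eq_tension_sub ν, inner_sub_left, inner_smul_left,
    real_inner_comm (tension ν v j) (ν (v j)), hK.inner_tension_normal hv,
    real_inner_self_eq_norm_sq]
  simp

/-- Pythagoras: tension and `unitMultiplier ν v j • ν (v j)` are the tangential and normal parts of
the Laplacian. -/
theorem GeometryBound.sq_norm_lap_le (hK : GeometryBound N ν K) (hv : ∀ j, v j ∈ N) (j : Grid) :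
    ‖lap v j‖ ^ 2 ≤ ‖tension ν v j‖ ^ 2 + K ^ 2 * gradSq v j ^ 2 := by
  have h1 : ‖lap v j‖ ^ 2 = ‖tension ν v j‖ ^ 2 + unitMultiplier ν v j ^ 2 := by
    rw [lap_eq_tension_sub ν, norm_sub_sq_real, inner_smul_right, hK.inner_tension_normal hv,
      norm_smul, hK.norm_normal _ (hv j), Real.norm_eq_abs, mul_one, sq_abs]
    ring
  rw [h1, ← mul_pow, ← sq_abs (unitMultiplier ν v j)]
  gcongr
  exact hK.abs_unitMultiplier_le hv j

end Pointwise

/-! ### Local energy inequality and evolution of the tension -/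

section Energy

variable {S : Finset Grid} {N : Set Space} {ν : Space → Space} {K κ : ℝ} {ψ φ : Grid → ℝ}

/-- The energy localized by a cutoff function. -/
noncomputable def cutoffEnergy (S : Finset Grid) (ψ : Grid → ℝ) (v : Grid → Space) : ℝ :=
  1 / 4 * ∑ j ∈ S, ∑ a, ψ j * ψ (j + dir a) * ‖del a v j‖ ^ 2

theorem IsCutoff.cutoffEnergy_nonneg (hψ : IsCutoff S κ ψ) (v : Grid → Space) :
    0 ≤ cutoffEnergy S ψ v :=
  mul_nonneg (by norm_num) (Finset.sum_nonneg fun _ _ => Finset.sum_nonneg fun _ _ =>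
    mul_nonneg (mul_nonneg (hψ.nonneg _) (hψ.nonneg _)) (sq_nonneg _))

theorem IsCutoff.cutoffEnergy_le (hψ : IsCutoff S κ ψ) (v : Grid → Space) :
    cutoffEnergy S ψ v ≤ 1 / 4 * ∑ j ∈ S, gradSq v j := by
  rw [cutoffEnergy]
  gcongr
  rw [gradSq]
  gcongr
  exact mul_le_of_le_one_left (sq_nonneg _)
    (mul_le_one₀ (hψ.le_one _) (hψ.nonneg _) (hψ.le_one _))

theorem IsCutoff.sum_gradSq_le_cutoffEnergy (hψ : IsCutoff S κ ψ) (v : Grid → Space)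
    {T : Finset Grid} (hT : ∀ j ∈ T, ψ j = 1 ∧ ∀ a, ψ (j + dir a) = 1) :
    1 / 4 * ∑ j ∈ T, gradSq v j ≤ cutoffEnergy S ψ v := by
  rw [cutoffEnergy]
  gcongr
  have hTS : T ⊆ S := fun j hj => hψ.supp.mem (by rw [(hT j hj).1]; norm_num)
  refine le_trans (le_of_eq ?_) (Finset.sum_le_sum_of_subset_of_nonneg hTS fun _ _ _ =>
    Finset.sum_nonneg fun _ _ =>
      mul_nonneg (mul_nonneg (hψ.nonneg _) (hψ.nonneg _)) (sq_nonneg _))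
  refine Finset.sum_congr rfl fun j hj => ?_
  rw [gradSq]
  refine Finset.sum_congr rfl fun a _ => ?_
  rw [(hT j hj).1, (hT j hj).2 a]
  ring

/-- Summation by parts for the first variation of the localized energy. -/
theorem IsCutoff.sum_inner_del_del (hψ : IsCutoff S κ ψ) (v w : Grid → Space) :
    ∑ j ∈ S, ∑ a, ψ j * ψ (j + dir a) * inner ℝ (del a v j) (del a w j) =
      -2 * ∑ j ∈ S, ∑ a, ψ j * ψ (j + dir a) * inner ℝ (del a v j) (w j) := by
  -- The edge weight is symmetric in its endpoints while the difference of `v` changes sign, so the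
  -- two halves of `del a w` contribute equally.
  have key := sum_swap (S := S) (fun j k => ψ j * ψ k * inner ℝ (v k - v j) (w k)) fun j a h =>
    ⟨hψ.supp.mem fun h0 => h (by simp [h0]), hψ.supp.mem fun h0 => h (by simp [h0])⟩
  calc _ = ∑ j ∈ S, ∑ a, ψ j * ψ (j + dir a) * inner ℝ (v (j + dir a) - v j) (w (j + dir a)) -
        ∑ j ∈ S, ∑ a, ψ j * ψ (j + dir a) * inner ℝ (del a v j) (w j) := by
        simp only [← Finset.sum_sub_distrib]
        refine Finset.sum_congr rfl fun j _ => Finset.sum_congr rfl fun a _ => ?_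
        rw [del_apply a w, inner_sub_right, del_apply]
        ring
    _ = _ := by
        rw [key, Finset.mul_sum, ← Finset.sum_sub_distrib]
        refine Finset.sum_congr rfl fun j _ => ?_
        rw [Finset.mul_sum, ← Finset.sum_sub_distrib]
        refine Finset.sum_congr rfl fun a _ => ?_
        rw [← neg_sub (v (j + dir a)), inner_neg_left, del_apply]
        ring

/-- Writing `ψ (j + dir a) = ψ j + del a ψ j` separates the dissipation from a commutator. Young's
inequality spends `1 / 8` of the dissipation on each of the four directions, which leaves one half.
-/
theorem IsCutoff.energy_variation_le (hψ : IsCutoff S κ ψ) (hκ : 0 ≤ κ) {v w : Grid → Space}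
    (hw : ∀ j, inner ℝ (lap v j) (w j) = ‖w j‖ ^ 2) :
    1 / 2 * ∑ j ∈ S, ∑ a, ψ j * ψ (j + dir a) * inner ℝ (del a v j) (del a w j) ≤
      -(1 / 2) * ∑ j ∈ S, ψ j ^ 2 * ‖w j‖ ^ 2 + 2 * κ ^ 2 * ∑ j ∈ S, gradSq v j := by
  rw [hψ.sum_inner_del_del, ← mul_assoc, Finset.mul_sum, Finset.mul_sum, Finset.mul_sum,
    ← Finset.sum_add_distrib]
  refine Finset.sum_le_sum fun j _ => ?_
  have h1 : ∑ a, ψ j * ψ (j + dir a) * inner ℝ (del a v j) (w j) =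
      ψ j ^ 2 * ‖w j‖ ^ 2 + ∑ a, ψ j * del a ψ j * inner ℝ (del a v j) (w j) := by
    rw [← hw, lap, sum_inner, Finset.mul_sum, ← Finset.sum_add_distrib]
    refine Finset.sum_congr rfl fun a _ => ?_
    rw [del_apply a ψ]
    ring
  have h2 : ∀ a, -(ψ j * del a ψ j * inner ℝ (del a v j) (w j)) ≤
      1 / 8 * (ψ j ^ 2 * ‖w j‖ ^ 2) + 2 * κ ^ 2 * ‖del a v j‖ ^ 2 := fun a => by
    refine (neg_le_abs _).trans ?_
    rw [abs_mul, abs_mul, abs_of_nonneg (hψ.nonneg j)]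
    have h3 : ψ j * |del a ψ j| * |inner ℝ (del a v j) (w j)| ≤
        ψ j * κ * (‖del a v j‖ * ‖w j‖) := by
      have h4 := hψ.nonneg j
      have h5 := hψ.abs_del_le a j
      have h6 := abs_real_inner_le_norm (del a v j) (w j)
      gcongr
    nlinarith [sq_nonneg (ψ j * ‖w j‖ - 4 * (κ * ‖del a v j‖))]
  have h3 := Finset.sum_le_sum (s := Finset.univ) fun a _ => h2 a
  simp only [Finset.sum_neg_distrib, Finset.sum_add_distrib, ← Finset.mul_sum, Finset.sum_const,
    Finset.card_univ, Fintype.card_sum, Fintype.card_fin, nsmul_eq_mul] at h3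
  have h4 : ∑ a, ‖del a v j‖ ^ 2 = gradSq v j := rfl
  rw [h1]
  rw [h4] at h3
  push_cast at h3
  linarith

theorem IsUnitFlow.hasDerivWithinAt_del {u : ℝ → Grid → Space} (hu : IsUnitFlow N ν u) {t : ℝ}
    (ht : 0 ≤ t) (a : Dir) (j : Grid) :
    HasDerivWithinAt (fun s => del a (u s) j) (del a (tension ν (u t)) j) (Set.Ici 0) t :=
  (hu.hasDeriv t ht _).sub (hu.hasDeriv t ht _)

theorem IsUnitFlow.hasDerivWithinAt_cutoffEnergy {u : ℝ → Grid → Space} (hu : IsUnitFlow N ν u)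
    {t : ℝ} (ht : 0 ≤ t) (S : Finset Grid) (ψ : Grid → ℝ) :
    HasDerivWithinAt (fun s => cutoffEnergy S ψ (u s))
      (1 / 2 * ∑ j ∈ S, ∑ a, ψ j * ψ (j + dir a) *
        inner ℝ (del a (u t) j) (del a (tension ν (u t)) j)) (Set.Ici 0) t := by
  have h := (HasDerivWithinAt.fun_sum (u := S) fun j _ =>
    HasDerivWithinAt.fun_sum (u := Finset.univ) fun a _ =>
      ((hu.hasDerivWithinAt_del ht a j).norm_sq).const_mul (ψ j * ψ (j + dir a))).const_mul
        (1 / 4 : ℝ)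
  refine h.congr_deriv ?_
  simp only [Finset.mul_sum]
  refine Finset.sum_congr rfl fun j _ => Finset.sum_congr rfl fun a _ => ?_
  ring

theorem le_of_hasDerivWithinAt_nonpos {f f' : ℝ → ℝ} {a b : ℝ} (ha : 0 ≤ a) (hab : a ≤ b)
    (hf : ∀ t, 0 ≤ t → HasDerivWithinAt f (f' t) (Set.Ici 0) t)
    (h : ∀ t ∈ Set.Icc a b, f' t ≤ 0) : f b ≤ f a := by
  refine antitoneOn_of_hasDerivWithinAt_nonpos (f' := f') (convex_Icc a b)
    (fun t ht => ?_) (fun t ht => ?_) (fun t ht => ?_) (Set.left_mem_Icc.2 hab)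
    (Set.right_mem_Icc.2 hab) hab
  · exact (hf t (ha.trans ht.1)).continuousWithinAt.mono fun s hs => ha.trans hs.1
  · rw [interior_Icc] at ht ⊢
    exact (hf t (ha.trans ht.1.le)).mono fun s hs => ha.trans hs.1.le
  · rw [interior_Icc] at ht
    exact h t ⟨ht.1.le, ht.2.le⟩

/-- The local energy inequality. -/
theorem IsUnitFlow.cutoffEnergy_le {u : ℝ → Grid → Space} (hu : IsUnitFlow N ν u)
    (hK : GeometryBound N ν K) (hψ : IsCutoff S κ ψ) (hκ : 0 ≤ κ) {t₀ t₁ A : ℝ} (ht₀ : 0 ≤ t₀)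
    (ht : t₀ ≤ t₁) (hA : ∀ t ∈ Set.Icc t₀ t₁, ∑ j ∈ S, gradSq (u t) j ≤ A) :
    cutoffEnergy S ψ (u t₁) ≤ cutoffEnergy S ψ (u t₀) + 2 * κ ^ 2 * A * (t₁ - t₀) := by
  have key := le_of_hasDerivWithinAt_nonpos ht₀ ht
    (f := fun t => cutoffEnergy S ψ (u t) - 2 * κ ^ 2 * A * t)
    (fun t h => (hu.hasDerivWithinAt_cutoffEnergy h S ψ).sub
      ((hasDerivWithinAt_id t _).const_mul (2 * κ ^ 2 * A))) fun t h => ?_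
  · linarith
  · have h1 := hψ.energy_variation_le hκ
      (hK.inner_lap_tension (hu.mem t (ht₀.trans h.1)))
    have h2 : 2 * κ ^ 2 * ∑ j ∈ S, gradSq (u t) j ≤ 2 * κ ^ 2 * A := by
      gcongr; exact hA t h
    have h3 : 0 ≤ ∑ j ∈ S, ψ j ^ 2 * ‖tension ν (u t) j‖ ^ 2 :=
      Finset.sum_nonneg fun _ _ => by positivity
    linarith

/-- Summation by parts for the Laplacian, localized by a cutoff function. -/
theorem sum_cutoff_inner_lap (hφ : SupportedInside S φ) (w : Grid → Space) :
    2 * ∑ j ∈ S, φ j ^ 2 * inner ℝ (w j) (lap w j) =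
      -∑ j ∈ S, gradSq (fun k => φ k • w k) j +
        ∑ j ∈ S, ∑ a, del a φ j ^ 2 * inner ℝ (w (j + dir a)) (w j) := by
  have key := sum_swap (S := S) (fun j k => φ j ^ 2 * inner ℝ (w j) (w k - w j)) fun j a h =>
    have h0 : φ j ≠ 0 := fun h0 => h (by simp [h0])
    ⟨hφ.mem h0, hφ.add_dir_mem h0 a⟩
  have h1 : ∑ j ∈ S, φ j ^ 2 * inner ℝ (w j) (lap w j) =
      ∑ j ∈ S, ∑ a, φ j ^ 2 * inner ℝ (w j) (w (j + dir a) - w j) := by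
    simp only [lap, inner_sum, Finset.mul_sum, del_apply]
  rw [two_mul]
  -- Only one of the two copies has its edges reversed; adding them completes the square of `del a
  -- (φ • w)`, with only the squared difference of `φ` left over.
  nth_rewrite 2 [h1]
  rw [key, h1, ← Finset.sum_add_distrib, ← Finset.sum_neg_distrib, ← Finset.sum_add_distrib]
  refine Finset.sum_congr rfl fun j _ => ?_
  rw [gradSq, ← Finset.sum_add_distrib, ← Finset.sum_neg_distrib, ← Finset.sum_add_distrib]
  refine Finset.sum_congr rfl fun a _ => ?_
  simp only [del_apply]
  rw [norm_sub_sq_real, inner_smul_left, inner_smul_right, norm_smul, norm_smul, mul_pow,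
    mul_pow, Real.norm_eq_abs, Real.norm_eq_abs, sq_abs, sq_abs, inner_sub_right,
    inner_sub_right, real_inner_self_eq_norm_sq, real_inner_self_eq_norm_sq,
    real_inner_comm (w (j + dir a)) (w j)]
  simp
  ring

/-- Wherever `φ` varies along an edge, `ψ` equals `1` at both endpoints, so the localization error
is charged to the tension in the larger region. -/
theorem IsCutoff.sum_cutoff_error_le (hφ : IsCutoff S κ φ) (hψ : IsCutoff S κ ψ)
    (hφψ : ∀ j, φ j ≠ 0 → ψ j = 1 ∧ ∀ a, ψ (j + dir a) = 1) (w : Grid → Space) :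
    ∑ j ∈ S, ∑ a, del a φ j ^ 2 * inner ℝ (w (j + dir a)) (w j) ≤
      4 * κ ^ 2 * ∑ j ∈ S, ψ j ^ 2 * ‖w j‖ ^ 2 := by
  have h1 : ∀ j a, del a φ j ^ 2 * inner ℝ (w (j + dir a)) (w j) ≤ κ ^ 2 / 2 *
      (ψ (j + dir a) ^ 2 * ‖w (j + dir a)‖ ^ 2 + ψ j ^ 2 * ‖w j‖ ^ 2) := fun j a => by
    by_cases h0 : del a φ j = 0
    · rw [h0]
      have : 0 ≤ κ ^ 2 / 2 *
        (ψ (j + dir a) ^ 2 * ‖w (j + dir a)‖ ^ 2 + ψ j ^ 2 * ‖w j‖ ^ 2) := by positivity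
      simpa using this
    · have h2 : ψ j = 1 ∧ ψ (j + dir a) = 1 := by
        by_cases h3 : φ j = 0
        · have h4 : φ (j + dir a) ≠ 0 := fun h => h0 (by rw [del_apply, h, h3, sub_zero])
          have h5 := (hφψ _ h4).2 a.swap
          rw [dir_swap, add_neg_cancel_right] at h5
          exact ⟨h5, (hφψ _ h4).1⟩
        · exact ⟨(hφψ j h3).1, (hφψ j h3).2 a⟩
      rw [h2.1, h2.2, ← sq_abs (del a φ j)]
      have h3 := real_inner_le_norm (w (j + dir a)) (w j)
      have h4 := two_mul_le_add_sq ‖w (j + dir a)‖ ‖w j‖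
      calc |del a φ j| ^ 2 * inner ℝ (w (j + dir a)) (w j)
          ≤ |del a φ j| ^ 2 * ((‖w (j + dir a)‖ ^ 2 + ‖w j‖ ^ 2) / 2) := by
            gcongr; linarith
        _ ≤ κ ^ 2 * ((‖w (j + dir a)‖ ^ 2 + ‖w j‖ ^ 2) / 2) := by
            gcongr; exact hφ.abs_del_le a j
        _ = _ := by ring
  have h2 : ∀ a, ∑ j ∈ S, ψ (j + dir a) ^ 2 * ‖w (j + dir a)‖ ^ 2 =
      ∑ j ∈ S, ψ j ^ 2 * ‖w j‖ ^ 2 := fun a =>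
    sum_shift (dir a) (fun k => ψ k ^ 2 * ‖w k‖ ^ 2) fun j hj =>
      have h0 : ψ j ≠ 0 := fun h => hj (by simp [h])
      ⟨hψ.supp.mem h0, hψ.supp.sub_dir_mem h0 a⟩
  refine (Finset.sum_le_sum fun j _ => Finset.sum_le_sum fun a _ => h1 j a).trans (le_of_eq ?_)
  rw [Finset.sum_comm]
  simp only [← Finset.mul_sum, Finset.sum_add_distrib, h2]
  simp
  ring

/-- The nonlinear term in the equation for the time derivative is absorbed. -/
theorem sum_gradSq_mul_le (hφ : IsCutoff S κ φ)
    (hφψ : ∀ j, φ j ≠ 0 → ψ j = 1 ∧ ∀ a, ψ (j + dir a) = 1) (v w : Grid → Space) :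
    2 * K ^ 2 * ∑ j ∈ S, gradSq v j * (φ j ^ 2 * ‖w j‖ ^ 2) ≤
      ∑ j ∈ S, gradSq (fun k => φ k • w k) j + 4 * K ^ 4 *
        (∑ j ∈ S, ψ j ^ 2 * gradSq v j ^ 2) * ∑ j ∈ S, φ j ^ 2 * ‖w j‖ ^ 2 := by
  have hf : SupportedInside S fun k => φ k • w k := fun j hj =>
    hφ.supp j fun h => hj (by simp [h])
  have hn : ∀ j, ‖φ j • w j‖ ^ 2 = φ j ^ 2 * ‖w j‖ ^ 2 := fun j => by
    rw [norm_smul, mul_pow, Real.norm_eq_abs, sq_abs]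
  have h4 := sum_norm_pow_four_le hf
  simp only [hn] at h4
  have h1 : ∑ j ∈ S, gradSq v j * (φ j ^ 2 * ‖w j‖ ^ 2) =
      ∑ j ∈ S, (ψ j * gradSq v j) * (φ j ^ 2 * ‖w j‖ ^ 2) := by
    refine Finset.sum_congr rfl fun j _ => ?_
    by_cases h0 : φ j = 0
    · simp [h0]
    · rw [(hφψ j h0).1, one_mul]
  have h2 := Finset.sum_mul_sq_le_sq_mul_sq S (fun j => ψ j * gradSq v j)
    fun j => φ j ^ 2 * ‖w j‖ ^ 2
  rw [← h1] at h2
  simp only [mul_pow (ψ _)] at h2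
  set s := ∑ j ∈ S, gradSq v j * (φ j ^ 2 * ‖w j‖ ^ 2)
  set D := ∑ j ∈ S, gradSq (fun k => φ k • w k) j
  set G := ∑ j ∈ S, ψ j ^ 2 * gradSq v j ^ 2
  set X := ∑ j ∈ S, φ j ^ 2 * ‖w j‖ ^ 2
  have hG : 0 ≤ G := Finset.sum_nonneg fun _ _ => by positivity
  have hX : 0 ≤ X := Finset.sum_nonneg fun _ _ => by positivity
  have hD : 0 ≤ D := Finset.sum_nonneg fun _ _ => gradSq_nonneg _ _
  have h3 : s ^ 2 ≤ G * (4 * X * D) := h2.trans (by gcongr)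
  -- Squares are compared so that Young's inequality takes the form `4 * D * Q ≤ (D + Q) ^ 2`,
  -- without square roots.
  refine le_of_sq_le_sq ?_ (by positivity)
  calc (2 * K ^ 2 * s) ^ 2 = 4 * K ^ 4 * s ^ 2 := by ring
    _ ≤ 4 * K ^ 4 * (G * (4 * X * D)) := by gcongr
    _ = 4 * D * (4 * K ^ 4 * G * X) := by ring
    _ ≤ (D + 4 * K ^ 4 * G * X) ^ 2 := by nlinarith [sq_nonneg (D - 4 * K ^ 4 * G * X)]

/-- In the time derivative of the tension, the derivative of the multiplier appears along `ν` and
disappears when tested against the tangential tension. What remains is the multiplier times the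
derivative of the normal; each factor contributes one `K`. -/
theorem IsUnitFlow.exists_hasDerivWithinAt_tension {u : ℝ → Grid → Space}
    (hu : IsUnitFlow N ν u) (hK : GeometryBound N ν K) (hν : IsHypersurfaceWithNormal N ν)
    {t : ℝ} (ht : 0 ≤ t) (j : Grid) :
    ∃ z : Space, HasDerivWithinAt (fun s => tension ν (u s) j) z (Set.Ici 0) t ∧
      inner ℝ (tension ν (u t) j) z ≤ inner ℝ (tension ν (u t) j) (lap (tension ν (u t)) j) +
        K ^ 2 * gradSq (u t) j * ‖tension ν (u t) j‖ ^ 2 := by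
  obtain ⟨m, hm, hmK⟩ := hK.exists_hasDerivWithinAt_normal hν ht (fun s hs => hu.mem s hs j)
    (hu.hasDeriv t ht j)
  have hlap : HasDerivWithinAt (fun s => lap (u s) j) (lap (tension ν (u t)) j) (Set.Ici 0) t :=
    HasDerivWithinAt.fun_sum fun a _ => hu.hasDerivWithinAt_del ht a j
  have hmul := (hlap.inner ℝ hm).neg
  refine ⟨_, hlap.add (hmul.smul hm), ?_⟩
  have h0 := hK.inner_tension_normal (hu.mem t ht) j
  have hlam := hK.abs_unitMultiplier_le (hu.mem t ht) j
  have h1 : unitMultiplier ν (u t) j * inner ℝ (tension ν (u t) j) m ≤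
      K ^ 2 * gradSq (u t) j * ‖tension ν (u t) j‖ ^ 2 := by
    refine (le_abs_self _).trans ?_
    rw [abs_mul]
    calc _ ≤ (K * gradSq (u t) j) * (‖tension ν (u t) j‖ * (K * ‖tension ν (u t) j‖)) := by
          gcongr
          · exact (abs_nonneg _).trans hlam
          · exact (abs_real_inner_le_norm _ _).trans (by gcongr)
      _ = _ := by ring
  rw [inner_add_right, inner_add_right, inner_smul_right, inner_smul_right, h0, mul_zero,
    add_zero]
  exact add_le_add_right h1 _

end Energy

theorem le_of_exists_hasDerivWithinAt_nonpos {f : ℝ → ℝ} {a b : ℝ} (ha : 0 ≤ a) (hab : a ≤ b)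
    (hf : ∀ t, 0 ≤ t → ∃ f', HasDerivWithinAt f f' (Set.Ici 0) t ∧
      (t ∈ Set.Icc a b → f' ≤ 0)) : f b ≤ f a := by
  have h : ∀ t, ∃ f', 0 ≤ t → HasDerivWithinAt f f' (Set.Ici 0) t ∧
      (t ∈ Set.Icc a b → f' ≤ 0) := fun t => by
    by_cases ht : 0 ≤ t
    · exact (hf t ht).imp fun _ h _ => h
    · exact ⟨0, fun h => absurd h ht⟩
  choose f' hf' using h
  exact le_of_hasDerivWithinAt_nonpos ha hab (fun t ht => (hf' t ht).1)
    fun t ht => (hf' t (ha.trans ht.1)).2 ht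

/-! ### Parabolic smoothing at small energy -/

/-- Additive constant of the elliptic estimate. -/
noncomputable def ellipticConst (K B : ℝ) : ℝ := 1700 + 320 * K ^ 2 * B

/-- Growth constant of the localized tension. -/
noncomputable def growthConst (K B : ℝ) : ℝ := 4 * K ^ 4 * (48 + ellipticConst K B)

/-- The weight of the energy in the smoothing estimate. -/
noncomputable def weightConst (K B M : ℝ) : ℝ := 2 * (1 + growthConst K B + 4 * M)

/-- The constant of the smoothing estimate. -/
noncomputable def smoothingConst (K B M : ℝ) : ℝ :=
  48 * Real.exp (weightConst K B M + (2 * weightConst K B M + growthConst K B) * M) +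
    M * ellipticConst K B

section Smoothing

variable {S : Finset Grid} {N : Set Space} {ν : Space → Space} {K B M ε κ : ℝ}
  {ψ φ : Grid → ℝ} {u : ℝ → Grid → Space}

/-- The localized squared norm of the tension. -/
noncomputable def cutoffTension (S : Finset Grid) (φ : Grid → ℝ) (ν : Space → Space)
    (v : Grid → Space) : ℝ :=
  ∑ j ∈ S, φ j ^ 2 * ‖tension ν v j‖ ^ 2

theorem cutoffTension_nonneg (v : Grid → Space) : 0 ≤ cutoffTension S φ ν v :=
  Finset.sum_nonneg fun _ _ => by positivity

/-- The evolution inequality for the localized tension. -/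
theorem IsUnitFlow.exists_hasDerivWithinAt_cutoffTension (hu : IsUnitFlow N ν u)
    (hK : GeometryBound N ν K) (hν : IsHypersurfaceWithNormal N ν)
    (hφ : IsCutoff S κ φ) (hψ : IsCutoff S κ ψ)
    (hφψ : ∀ j, φ j ≠ 0 → ψ j = 1 ∧ ∀ a, ψ (j + dir a) = 1) {t : ℝ} (ht : 0 ≤ t) :
    ∃ X', HasDerivWithinAt (fun s => cutoffTension S φ ν (u s)) X' (Set.Ici 0) t ∧
      X' ≤ 4 * κ ^ 2 * cutoffTension S ψ ν (u t) + 4 * K ^ 4 *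
        (∑ j ∈ S, ψ j ^ 2 * gradSq (u t) j ^ 2) * cutoffTension S φ ν (u t) := by
  choose z hz hzle using fun j => hu.exists_hasDerivWithinAt_tension hK hν ht j
  refine ⟨_, HasDerivWithinAt.fun_sum fun j _ => ((hz j).norm_sq).const_mul (φ j ^ 2), ?_⟩
  have h1 := sum_cutoff_inner_lap hφ.supp (tension ν (u t))
  have h2 := hφ.sum_cutoff_error_le hψ hφψ (tension ν (u t))
  have h3 := sum_gradSq_mul_le (K := K) hφ hφψ (u t) (tension ν (u t))
  have h4 : ∑ j ∈ S, φ j ^ 2 * (2 * inner ℝ (tension ν (u t) j) (z j)) ≤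
      2 * ∑ j ∈ S, φ j ^ 2 * inner ℝ (tension ν (u t) j) (lap (tension ν (u t)) j) +
        2 * K ^ 2 * ∑ j ∈ S, gradSq (u t) j * (φ j ^ 2 * ‖tension ν (u t) j‖ ^ 2) := by
    rw [Finset.mul_sum, Finset.mul_sum, ← Finset.sum_add_distrib]
    refine Finset.sum_le_sum fun j _ => ?_
    have := mul_le_mul_of_nonneg_left (hzle j) (sq_nonneg (φ j))
    linarith
  simp only [cutoffTension]
  linarith

/-- The parabolic smoothing estimate on a region of small energy. -/
theorem IsUnitFlow.smoothing (hu : IsUnitFlow N ν u)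
    (hK : GeometryBound N ν K) (hν : IsHypersurfaceWithNormal N ν)
    (hφ : IsCutoff S κ φ) (hψ : IsCutoff S κ ψ)
    (hφψ : ∀ j, φ j ≠ 0 → ψ j = 1 ∧ ∀ a, ψ (j + dir a) = 1) (hκ : 0 ≤ κ)
    (hB : κ ^ 2 * S.card ≤ B) (hε : 384 * K ^ 2 * ε ≤ 1) {t₀ t₁ : ℝ} (ht₀ : 0 ≤ t₀)
    (ht : t₀ ≤ t₁) (hM : κ ^ 2 * (t₁ - t₀) ≤ M)
    (hsmall : ∀ t ∈ Set.Icc t₀ t₁, ∀ d : Grid, (∀ i, |d i| ≤ 1) →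
      ∑ j ∈ S, gradSq (u t) (j + d) ≤ ε) :
    (t₁ - t₀) * ∑ j ∈ S, φ j ^ 2 * hessSq (u t₁) j ≤ smoothingConst K B M := by
  have hsmall0 : ∀ t ∈ Set.Icc t₀ t₁, ∑ j ∈ S, gradSq (u t) j ≤ ε := fun t h => by
    simpa using hsmall t h 0 (by simp)
  have hε0 : 0 ≤ ε := (Finset.sum_nonneg fun j _ => gradSq_nonneg _ _).trans
    (hsmall0 t₀ (Set.left_mem_Icc.2 ht))
  have hKsq : 1 ≤ K ^ 2 := one_le_pow₀ hK.one_le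
  have hε1 : ε ≤ 1 := by nlinarith
  have hB0 : 0 ≤ B := le_trans (by positivity) hB
  have hM0 : 0 ≤ M := le_trans (mul_nonneg (sq_nonneg _) (sub_nonneg.2 ht)) hM
  have hell : ∀ t ∈ Set.Icc t₀ t₁, ∀ η, IsCutoff S κ η →
      ∑ j ∈ S, η j ^ 2 * hessSq (u t) j ≤
        48 * cutoffTension S η ν (u t) + κ ^ 2 * ellipticConst K B ∧
      ∑ j ∈ S, η j ^ 2 * gradSq (u t) j ^ 2 ≤
        48 * cutoffTension S η ν (u t) + κ ^ 2 * ellipticConst K B := fun t h η hη =>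
    have h0 := ht₀.trans h.1
    hη.sum_hessSq_le_of_small hκ hK.one_le (fun j => hK.norm_le _ (hu.mem t h0 j)) hB hε
      (hsmall t h) (hK.sq_norm_lap_le (hu.mem t h0))
  have hC : 0 ≤ ellipticConst K B := by rw [ellipticConst]; positivity
  have hA : 0 ≤ growthConst K B := by rw [growthConst]; positivity
  have hα : 0 ≤ weightConst K B M := by rw [weightConst]; positivity
  set C := ellipticConst K B with hCdef
  set A := growthConst K B with hAdef
  set α := weightConst K B M with hαdef
  set X : ℝ → ℝ := fun t => cutoffTension S φ ν (u t) with hXdef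
  -- Gronwall without integrals: the energy in the exponent decays at rate `Y / 2` up to `2 * κ ^
  -- 2`, which compensates growth at a rate proportional to `Y + κ ^ 2`. The factor `t - t₀` removes
  -- the initial tension. The summand `1` lets terms linear in `Y` be absorbed as multiples of `Y *
  -- Z`.
  have hmono : (fun t => ((t - t₀) * X t + 1) *
      Real.exp (α * cutoffEnergy S ψ (u t) - (2 * α + A) * κ ^ 2 * (t - t₀))) t₁ ≤
      (fun t => ((t - t₀) * X t + 1) *
      Real.exp (α * cutoffEnergy S ψ (u t) - (2 * α + A) * κ ^ 2 * (t - t₀))) t₀ := by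
    refine le_of_exists_hasDerivWithinAt_nonpos (f := fun t => ((t - t₀) * X t + 1) *
      Real.exp (α * cutoffEnergy S ψ (u t) - (2 * α + A) * κ ^ 2 * (t - t₀)))
      ht₀ ht fun t h0 => ?_
    obtain ⟨X', hX', hX'le⟩ :=
      hu.exists_hasDerivWithinAt_cutoffTension hK hν hφ hψ hφψ h0
    have hE := hu.hasDerivWithinAt_cutoffEnergy h0 S ψ
    have hid : HasDerivWithinAt (fun s => s - t₀) 1 (Set.Ici 0) t :=
      (hasDerivWithinAt_id t _).sub_const t₀
    refine ⟨_, ((hid.mul hX').add_const 1).mul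
      ((hE.const_mul α).sub (hid.const_mul ((2 * α + A) * κ ^ 2))).exp, fun hmem => ?_⟩
    have hE' := hψ.energy_variation_le hκ (hK.inner_lap_tension (hu.mem t h0))
    have hgrad : 2 * κ ^ 2 * ∑ j ∈ S, gradSq (u t) j ≤ 2 * κ ^ 2 * 1 := by
      gcongr; exact (hsmall0 t hmem).trans hε1
    have hG := (hell t hmem ψ hψ).2
    have hXY : X t ≤ cutoffTension S ψ ν (u t) := by
      refine Finset.sum_le_sum fun j _ => ?_
      by_cases hj : φ j = 0
      · rw [hj]
        have : 0 ≤ ψ j ^ 2 * ‖tension ν (u t) j‖ ^ 2 := by positivity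
        simpa using this
      · rw [(hφψ j hj).1]
        gcongr
        exacts [hφ.nonneg j, hφ.le_one j]
    have hX0 : 0 ≤ X t := cutoffTension_nonneg _
    have hXt : cutoffTension S φ ν (u t) = X t := rfl
    rw [← cutoffTension] at hE'
    rw [hXt] at hX'le
    set Y := cutoffTension S ψ ν (u t)
    set e' := 1 / 2 * ∑ j ∈ S, ∑ a, ψ j * ψ (j + dir a) *
      inner ℝ (del a (u t) j) (del a (tension ν (u t)) j)
    set G := ∑ j ∈ S, ψ j ^ 2 * gradSq (u t) j ^ 2
    have hY0 : 0 ≤ Y := hX0.trans hXY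
    have hs0 : 0 ≤ t - t₀ := sub_nonneg.2 hmem.1
    have hs1 : κ ^ 2 * (t - t₀) ≤ M :=
      le_trans (by gcongr; exact hmem.2) hM
    have hGX : 4 * K ^ 4 * G * X t ≤ A * (Y + κ ^ 2) * X t := by
      have hG' : G ≤ (48 + C) * (Y + κ ^ 2) := by
        linarith [sq_nonneg κ, mul_nonneg hC hY0]
      calc 4 * K ^ 4 * G * X t ≤ 4 * K ^ 4 * ((48 + C) * (Y + κ ^ 2)) * X t := by gcongr
        _ = A * (Y + κ ^ 2) * X t := by rw [hAdef, growthConst]; ring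
    set Z := (t - t₀) * X t + 1 with hZ
    have hZ1 : 1 ≤ Z := by
      rw [hZ]
      linarith [mul_nonneg hs0 hX0]
    have b1 : (t - t₀) * X' ≤ 4 * M * (Y * Z) + A * (Y + κ ^ 2) * Z := by
      calc (t - t₀) * X' ≤ (t - t₀) * (4 * κ ^ 2 * Y + A * (Y + κ ^ 2) * X t) := by
            gcongr; linarith
        _ = 4 * (κ ^ 2 * (t - t₀)) * (Y * 1) + A * (Y + κ ^ 2) * ((t - t₀) * X t) := by ring
        _ ≤ _ := by
            gcongr
            rw [hZ]; linarith
    have b2 : X t ≤ Y * Z := hXY.trans (le_mul_of_one_le_right hY0 hZ1)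
    have b3 : α * e' - (2 * α + A) * κ ^ 2 ≤ -(1 / 2) * α * Y - A * κ ^ 2 := by
      have : α * e' ≤ α * (-(1 / 2) * Y + 2 * κ ^ 2 * 1) := by gcongr; linarith
      linarith
    have b4 : Z * (α * e' - (2 * α + A) * κ ^ 2) ≤ Z * (-(1 / 2) * α * Y - A * κ ^ 2) := by
      gcongr
    -- The coefficient of `Y * Z` is at most `1 + A + 4 * M`, exactly `α / 2`; this is the origin of
    -- `weightConst`.
    have b5 : 1 * X t + (t - t₀) * X' + Z * (α * e' - (2 * α + A) * κ ^ 2) ≤ 0 := by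
      have : α = 2 * (1 + A + 4 * M) := rfl
      rw [this] at b4 ⊢
      linarith
    have := mul_nonpos_of_nonpos_of_nonneg b5 (Real.exp_pos
      (α * cutoffEnergy S ψ (u t) - (2 * α + A) * κ ^ 2 * (t - t₀))).le
    refine le_trans (le_of_eq ?_) this
    simp only [Pi.mul_apply, Pi.sub_apply, hXt, hZ]
    ring
  simp only [sub_self, zero_mul, zero_add, mul_zero, sub_zero, one_mul] at hmono
  have hs0 : 0 ≤ t₁ - t₀ := sub_nonneg.2 ht
  have hX0 : 0 ≤ X t₁ := cutoffTension_nonneg _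
  have hE0 : cutoffEnergy S ψ (u t₀) ≤ 1 := by
    have h1 := hψ.cutoffEnergy_le (u t₀)
    have h2 := hsmall0 t₀ (Set.left_mem_Icc.2 ht)
    linarith
  have hE1 := hψ.cutoffEnergy_nonneg (u t₁)
  have hX : (t₁ - t₀) * X t₁ ≤ Real.exp (α + (2 * α + A) * M) := by
    have h1 : (2 * α + A) * κ ^ 2 * (t₁ - t₀) ≤ (2 * α + A) * M := by
      rw [mul_assoc]; gcongr
    have h2 : α * cutoffEnergy S ψ (u t₀) ≤ α := mul_le_of_le_one_right hα hE0
    have h3 : 0 ≤ α * cutoffEnergy S ψ (u t₁) := mul_nonneg hα hE1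
    have h4 : ((t₁ - t₀) * X t₁ + 1) * Real.exp (-((2 * α + A) * M)) ≤ Real.exp α := by
      refine le_trans ?_ (hmono.trans (Real.exp_le_exp.2 h2))
      gcongr
      linarith
    rw [Real.exp_neg, ← div_eq_mul_inv, div_le_iff₀ (Real.exp_pos _), ← Real.exp_add] at h4
    linarith
  have hfin := (hell t₁ (Set.right_mem_Icc.2 ht) φ hφ).1
  calc (t₁ - t₀) * ∑ j ∈ S, φ j ^ 2 * hessSq (u t₁) j
      ≤ (t₁ - t₀) * (48 * X t₁ + κ ^ 2 * C) := by gcongr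
    _ = 48 * ((t₁ - t₀) * X t₁) + (κ ^ 2 * (t₁ - t₀)) * C := by ring
    _ ≤ _ := by rw [smoothingConst]; gcongr

end Smoothing

/-! ### Lattice discs and scale-invariant cutoffs -/

theorem gridPoint_one_add (j d : Grid) : gridPoint 1 (j + d) = gridPoint 1 j + gridPoint 1 d := by
  ext i
  simp [gridPoint]

theorem norm_gridPoint_one_le {d : Grid} {n : ℤ} (hd : ∀ i, |d i| ≤ n) :
    ‖gridPoint 1 d‖ ≤ 3 / 2 * n := by
  have hn : (0 : ℝ) ≤ n := by exact_mod_cast (abs_nonneg _).trans (hd 0)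
  have h : ∀ i, (d i : ℝ) ^ 2 ≤ (n : ℝ) ^ 2 := fun i => by
    rw [← sq_abs]
    gcongr
    exact_mod_cast hd i
  rw [EuclideanSpace.norm_eq, Fin.sum_univ_two]
  refine Real.sqrt_le_iff.2 ⟨by positivity, ?_⟩
  simp only [gridPoint, mul_one, Real.norm_eq_abs, sq_abs]
  nlinarith [h 0, h 1]

theorem norm_gridPoint_dir_le (a : Dir) : ‖gridPoint 1 (dir a)‖ ≤ 3 / 2 := by
  simpa using norm_gridPoint_one_le (n := 1) (abs_dir_le a)

theorem norm_gridPoint_add_sub_le (j d : Grid) (x : Plane) :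
    ‖gridPoint 1 (j + d) - x‖ ≤ ‖gridPoint 1 j - x‖ + ‖gridPoint 1 d‖ := by
  rw [gridPoint_one_add, add_sub_right_comm]
  exact norm_add_le _ _

theorem finite_latticeBall (x : Plane) (ρ : ℝ) : {j : Grid | ‖gridPoint 1 j - x‖ < ρ}.Finite := by
  refine (Finset.finite_toSet (Fintype.piFinset fun i => Finset.Icc ⌈x i - ρ⌉ ⌊x i + ρ⌋)).subset
    fun j hj => ?_
  rw [Finset.mem_coe, Fintype.mem_piFinset]
  intro i
  have h1 := (PiLp.norm_apply_le (gridPoint 1 j - x) i).trans_lt hj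
  have h2 := abs_lt.1 h1
  simp only [gridPoint, PiLp.sub_apply, mul_one] at h2
  rw [Finset.mem_Icc, Int.ceil_le, Int.le_floor]
  constructor <;> linarith

/-- The lattice points of the open disc of radius `ρ`. -/
noncomputable def latticeBall (x : Plane) (ρ : ℝ) : Finset Grid := (finite_latticeBall x ρ).toFinset

@[simp] theorem mem_latticeBall {x : Plane} {ρ : ℝ} {j : Grid} :
    j ∈ latticeBall x ρ ↔ ‖gridPoint 1 j - x‖ < ρ := by
  simp [latticeBall]

theorem card_latticeBall_le (x : Plane) {ρ : ℝ} (hρ : 0 ≤ ρ) :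
    ((latticeBall x ρ).card : ℝ) ≤ (2 * ρ + 1) ^ 2 := by
  have h1 : latticeBall x ρ ⊆ Fintype.piFinset fun i => Finset.Icc ⌈x i - ρ⌉ ⌊x i + ρ⌋ := by
    intro j hj
    rw [Fintype.mem_piFinset]
    intro i
    have h1 := (PiLp.norm_apply_le (gridPoint 1 j - x) i).trans_lt (mem_latticeBall.1 hj)
    have h2 := abs_lt.1 h1
    simp only [gridPoint, PiLp.sub_apply, mul_one] at h2
    rw [Finset.mem_Icc, Int.ceil_le, Int.le_floor]
    constructor <;> linarith
  have h2 : ∀ i : Fin 2, ((Finset.Icc ⌈x i - ρ⌉ ⌊x i + ρ⌋).card : ℝ) ≤ 2 * ρ + 1 := fun i => by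
    rw [Int.card_Icc]
    have h3 : ((⌊x i + ρ⌋ + 1 - ⌈x i - ρ⌉ : ℤ) : ℝ) ≤ 2 * ρ + 1 := by
      push_cast
      linarith [Int.floor_le (x i + ρ), Int.le_ceil (x i - ρ)]
    have h4 : ((Int.toNat (⌊x i + ρ⌋ + 1 - ⌈x i - ρ⌉) : ℤ) : ℝ) ≤ 2 * ρ + 1 := by
      rw [Int.toNat_eq_max, Int.cast_max]
      exact max_le h3 (by simp; linarith)
    exact_mod_cast h4
  calc ((latticeBall x ρ).card : ℝ)
      ≤ ((Fintype.piFinset fun i => Finset.Icc ⌈x i - ρ⌉ ⌊x i + ρ⌋).card : ℝ) := by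
        exact_mod_cast Finset.card_le_card h1
    _ = (Finset.Icc ⌈x 0 - ρ⌉ ⌊x 0 + ρ⌋).card * (Finset.Icc ⌈x 1 - ρ⌉ ⌊x 1 + ρ⌋).card := by
        rw [Fintype.card_piFinset, Fin.prod_univ_two]
        push_cast
        rfl
    _ ≤ (2 * ρ + 1) * (2 * ρ + 1) := by
        gcongr
        exacts [h2 0, h2 1]
    _ = _ := by ring

/-- First and second differences of a compactly supported smooth function. -/
theorem exists_difference_bound {g : Plane → ℝ} (hg : ContDiff ℝ 2 g) (hc : HasCompactSupport g) :
    ∃ M : ℝ, 1 ≤ M ∧ (∀ x a, |g (x + a) - g x| ≤ M * ‖a‖) ∧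
      ∀ x a b, |(g (x + a + b) - g (x + a)) - (g (x + b) - g x)| ≤ M * ‖a‖ * ‖b‖ := by
  obtain ⟨M₁, h₁⟩ := (hg.of_le one_le_two).lipschitzWith_of_hasCompactSupport hc one_ne_zero
  have hg' : ContDiff ℝ 1 (fderiv ℝ g) := hg.fderiv_right (by norm_num)
  obtain ⟨M₂, h₂⟩ := hg'.lipschitzWith_of_hasCompactSupport (hc.fderiv ℝ) one_ne_zero
  refine ⟨max 1 (max M₁ M₂), le_max_left _ _, fun x a => ?_, fun x a b => ?_⟩
  · have := h₁.norm_sub_le (x + a) x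
    rw [add_sub_cancel_left] at this
    refine this.trans ?_
    gcongr
    simp
  · have hd : Differentiable ℝ g := hg.differentiable two_ne_zero
    -- The mixed difference is an increment by `b` of the translate difference in direction `a`,
    -- whose derivative is bounded by `M₂ * ‖a‖`.
    have key := Convex.norm_image_sub_le_of_norm_hasFDerivWithin_le
      (f := fun y => g (y + a) - g y) (f' := fun y => fderiv ℝ g (y + a) - fderiv ℝ g y)
      (C := M₂ * ‖a‖) (s := Set.univ) (x := x) (y := x + b)
      (fun y _ => (((hasFDerivAt_comp_add_right a).2 (hd (y + a)).hasFDerivAt).sub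
        (hd y).hasFDerivAt).hasFDerivWithinAt)
      (fun y _ => by simpa using h₂.norm_sub_le (y + a) y) convex_univ trivial trivial
    rw [add_sub_cancel_left, add_right_comm] at key
    have e : (g (x + a + b) - g (x + a)) - (g (x + b) - g x) =
        (g (x + a + b) - g (x + b)) - (g (x + a) - g x) := by ring
    rw [e]
    refine key.trans ?_
    gcongr
    simp

/-- Cutoff functions between concentric discs of radii `r L < r' L`, with constants independent of
the scale `L`. -/
theorem exists_cutoff {r r' : ℝ} (hr : 0 < r) (hr' : r < r') :
    ∃ M : ℝ, 1 ≤ M ∧ ∀ (x : Plane) (L : ℝ), 0 < L → ∃ ψ : Grid → ℝ,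
      (∀ S : Finset Grid, latticeBall x (r' * L + 3) ⊆ S → IsCutoff S (M / L) ψ) ∧
      (∀ j, ‖gridPoint 1 j - x‖ ≤ r * L → ψ j = 1) ∧
      ∀ j, ψ j ≠ 0 → ‖gridPoint 1 j - x‖ < r' * L := by
  let η : ContDiffBump (0 : Plane) := ⟨r, r', hr, hr'⟩
  obtain ⟨M, hM, h1, h2⟩ := exists_difference_bound (g := η) η.contDiff η.hasCompactSupport
  refine ⟨3 / 2 * M, by linarith, fun x L hL => ?_⟩
  set p : Grid → Plane := fun j => L⁻¹ • (gridPoint 1 j - x) with hp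
  have hpadd : ∀ j d, p (j + d) = p j + L⁻¹ • gridPoint 1 d := fun j d => by
    simp only [hp, gridPoint_one_add]
    module
  have hpn : ∀ j, ‖p j‖ = L⁻¹ * ‖gridPoint 1 j - x‖ := fun j => by
    rw [hp, norm_smul, norm_inv, Real.norm_of_nonneg hL.le]
  have hdn : ∀ a, ‖L⁻¹ • gridPoint 1 (dir a)‖ ≤ 3 / 2 / L := fun a => by
    rw [norm_smul, norm_inv, Real.norm_of_nonneg hL.le, inv_mul_eq_div]
    gcongr
    exact norm_gridPoint_dir_le a
  have hsupp : ∀ j, η (p j) ≠ 0 → ‖gridPoint 1 j - x‖ < r' * L := fun j hj => by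
    have h3 : p j ∈ Metric.ball (0 : Plane) r' := by
      have : p j ∈ Function.support η := hj
      rwa [η.support_eq] at this
    rw [mem_ball_zero_iff, hpn, inv_mul_lt_iff₀ hL] at h3
    linarith
  refine ⟨fun j => η (p j), fun S hS => ⟨fun j => η.nonneg, fun j => η.le_one, fun a j => ?_,
    fun a b j => ?_, fun j hj d hd => hS ?_⟩, fun j hj => ?_, hsupp⟩
  · rw [del_apply, hpadd]
    refine (h1 _ _).trans ((mul_le_mul_of_nonneg_left (hdn a) (by linarith)).trans (le_of_eq ?_))
    ring
  · simp only [del_apply, hpadd]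
    refine (h2 _ _ _).trans ?_
    calc M * ‖L⁻¹ • gridPoint 1 (dir a)‖ * ‖L⁻¹ • gridPoint 1 (dir b)‖
        ≤ M * (3 / 2 / L) * (3 / 2 / L) := by gcongr <;> exact hdn _
      _ = 1 * M * (3 / 2 / L) ^ 2 := by ring
      -- The normalization `1 ≤ M` is used here, so that a single `κ` serves for first and second
      -- differences.
      _ ≤ M * M * (3 / 2 / L) ^ 2 := by gcongr
      _ = _ := by ring
  -- A displacement with coordinates at most `2` has length at most `3`, the margin in the radius
  -- `r' * L + 3`.
  · rw [mem_latticeBall]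
    have h3 := norm_gridPoint_add_sub_le j d x
    have h4 : ‖gridPoint 1 d‖ ≤ 3 / 2 * (2 : ℤ) := norm_gridPoint_one_le hd
    have h5 := hsupp j hj
    norm_num at h4
    linarith
  · refine η.one_of_mem_closedBall ?_
    rw [mem_closedBall_zero_iff, hpn, inv_mul_le_iff₀ hL]
    linarith

theorem IsCutoff.mono {S : Finset Grid} {κ κ' : ℝ} {ψ : Grid → ℝ} (hψ : IsCutoff S κ ψ)
    (hκ : 0 ≤ κ) (h : κ ≤ κ') : IsCutoff S κ' ψ where
  nonneg := hψ.nonneg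
  le_one := hψ.le_one
  abs_del_le a j := (hψ.abs_del_le a j).trans h
  abs_del_del_le a b j := (hψ.abs_del_del_le a b j).trans (by gcongr)
  supp := hψ.supp

theorem norm_del_le {v : Grid → Space} {K : ℝ} (hv : ∀ j, ‖v j‖ ≤ K) (a : Dir) (j : Grid) :
    ‖del a v j‖ ≤ 2 * K := by
  rw [two_mul]
  exact (norm_sub_le _ _).trans (add_le_add (hv _) (hv _))

theorem gradSq_le {v : Grid → Space} {K : ℝ} (hv : ∀ j, ‖v j‖ ≤ K) (j : Grid) :
    gradSq v j ≤ 16 * K ^ 2 := by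
  calc gradSq v j ≤ ∑ _a : Dir, (2 * K) ^ 2 := by
        rw [gradSq]; gcongr; exact norm_del_le hv _ _
    _ = _ := by simp; ring

theorem hessSq_le {v : Grid → Space} {K : ℝ} (hv : ∀ j, ‖v j‖ ≤ K) (j : Grid) :
    hessSq v j ≤ 256 * K ^ 2 := by
  calc hessSq v j ≤ ∑ _a : Dir, ∑ _b : Dir, (2 * (2 * K)) ^ 2 := by
        rw [hessSq]; gcongr; exact norm_del_le (norm_del_le hv _) _ _
    _ = _ := by simp; ring

/-! ### Global energy bound and regularity on the unit lattice -/

section Flow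

variable {N : Set Space} {ν : Space → Space} {K : ℝ} {u : ℝ → Grid → Space}

/-- The total energy does not increase along the flow. -/
theorem IsUnitFlow.sum_gradSq_le (hu : IsUnitFlow N ν u) (hK : GeometryBound N ν K) {E : ℝ}
    (hE : ∀ T : Finset Grid, 1 / 4 * ∑ j ∈ T, gradSq (u 0) j ≤ E) {t : ℝ} (ht : 0 ≤ t)
    (T : Finset Grid) : 1 / 4 * ∑ j ∈ T, gradSq (u t) j ≤ E := by
  obtain ⟨M, hM, hcut⟩ := exists_cutoff (r := 1 / 4) (r' := 1 / 2) (by norm_num) (by norm_num)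
  have main : ∀ (T : Finset Grid), ∃ L₀ : ℝ, 1 ≤ L₀ ∧ ∀ L, L₀ ≤ L → ∀ t, 0 ≤ t → ∀ F,
      (∀ s ∈ Set.Icc 0 t, ∑ j ∈ latticeBall 0 L, gradSq (u s) j ≤ F) →
      1 / 4 * ∑ j ∈ T, gradSq (u t) j ≤ E + 2 * (M / L) ^ 2 * F * t := by
    intro T
    have hρ : ∀ j ∈ T, ‖gridPoint 1 j‖ ≤ ∑ j ∈ T, ‖gridPoint 1 j‖ := fun j hj =>
      Finset.single_le_sum (f := fun j => ‖gridPoint 1 j‖) (fun _ _ => norm_nonneg _) hj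
    have hρ0 : 0 ≤ ∑ j ∈ T, ‖gridPoint 1 j‖ := Finset.sum_nonneg fun _ _ => norm_nonneg _
    set ρ := ∑ j ∈ T, ‖gridPoint 1 j‖
    refine ⟨4 * (ρ + 3), by linarith, fun L hL t ht F hF => ?_⟩
    have hL0 : 0 < L := by linarith
    obtain ⟨ψ, h1, h2, -⟩ := hcut 0 L hL0
    have hψ := h1 (latticeBall 0 L) fun j hj => by
      rw [mem_latticeBall] at hj ⊢
      linarith
    have h3 := hψ.sum_gradSq_le_cutoffEnergy (u t) (T := T) fun j hj => by
      have h4 := hρ j hj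
      refine ⟨h2 j (by rw [sub_zero]; linarith), fun a => h2 _ ?_⟩
      have h5 := norm_gridPoint_add_sub_le j (dir a) 0
      have h6 := norm_gridPoint_dir_le a
      rw [sub_zero (gridPoint 1 j)] at h5
      linarith
    have h4 := hu.cutoffEnergy_le hK hψ (by positivity) le_rfl ht hF
    have h5 := (hψ.cutoffEnergy_le (u 0)).trans (hE _)
    rw [sub_zero] at h4
    linarith
  -- A bootstrap, as summability at positive times is not known beforehand. The pointwise bound `16
  -- * K ^ 2` on a disc of area comparable to `L ^ 2` balances the factor `(M / L) ^ 2`. This yields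
  -- a bound independent of `T`; used as `F`, it makes the cutoff error vanish as `L → ∞`.
  have hrough : ∀ (T : Finset Grid) (t : ℝ), 0 ≤ t →
      1 / 4 * ∑ j ∈ T, gradSq (u t) j ≤ E + 288 * M ^ 2 * K ^ 2 * t := by
    intro T t ht
    obtain ⟨L, hL, h⟩ := main T
    refine (h L le_rfl t ht (144 * K ^ 2 * L ^ 2) fun s hs => ?_).trans (le_of_eq ?_)
    · calc ∑ j ∈ latticeBall 0 L, gradSq (u s) j
          ≤ ∑ j ∈ latticeBall 0 L, 16 * K ^ 2 := by
            gcongr with j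
            exact gradSq_le (fun j => hK.norm_le _ (hu.mem s hs.1 j)) j
        _ = (latticeBall 0 L).card * (16 * K ^ 2) := by rw [Finset.sum_const, nsmul_eq_mul]
        _ ≤ (2 * L + 1) ^ 2 * (16 * K ^ 2) := by
            gcongr; exact card_latticeBall_le 0 (by linarith)
        _ ≤ (3 * L) ^ 2 * (16 * K ^ 2) := by gcongr; linarith
        _ = _ := by ring
    · field_simp
      ring
  obtain ⟨L₀, hL₀, h⟩ := main T
  have hlim : Tendsto (fun L : ℝ => E + 2 * (M / L) ^ 2 *
      (4 * (E + 288 * M ^ 2 * K ^ 2 * t)) * t) atTop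
      (𝓝 (E + 2 * 0 ^ 2 * (4 * (E + 288 * M ^ 2 * K ^ 2 * t)) * t)) :=
    tendsto_const_nhds.add (((((tendsto_const_nhds.div_atTop tendsto_id).pow 2).const_mul
      2).mul_const _).mul_const _)
  refine (ge_of_tendsto hlim ?_).trans (le_of_eq (by ring))
  filter_upwards [eventually_ge_atTop L₀] with L hL
  refine h L hL t ht _ fun s hs => ?_
  have h1 := hrough (latticeBall 0 L) s hs.1
  have h2 : 288 * M ^ 2 * K ^ 2 * s ≤ 288 * M ^ 2 * K ^ 2 * t := by
    gcongr; exact hs.2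
  linarith

/-- Local `H²` regularity at small energy for the flow on the unit lattice. -/
theorem exists_unit_regularity (hK : GeometryBound N ν K) (hν : IsHypersurfaceWithNormal N ν) :
    ∃ ε₀ : ℝ, 0 < ε₀ ∧ ∀ E : ℝ, 0 ≤ E → ∃ δ : ℝ, 0 < δ ∧ ∀ θ : ℝ, 0 < θ → ∃ C : ℝ,
      ∀ u, IsUnitFlow N ν u → (∀ T : Finset Grid, 1 / 4 * ∑ j ∈ T, gradSq (u 0) j ≤ E) →
        ∀ (t₀ : ℝ) (x : Plane) (L : ℝ), 0 ≤ t₀ → 0 < L →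
          1 / 4 * ∑ j ∈ latticeBall x L, gradSq (u t₀) j ≤ ε₀ →
          ∀ t, t₀ + θ * L ^ 2 ≤ t → t ≤ t₀ + δ * L ^ 2 →
            L ^ 2 * ∑ j ∈ latticeBall x (L / 8), hessSq (u t) j ≤ C := by
  have hK1 := hK.one_le
  have hK0 : 0 < K := by linarith
  obtain ⟨M₁, hM₁, hcut₁⟩ := exists_cutoff (r := 2 / 8) (r' := 3 / 8) (by norm_num) (by norm_num)
  obtain ⟨M₂, hM₂, hcut₂⟩ := exists_cutoff (r := 4 / 8) (r' := 5 / 8) (by norm_num) (by norm_num)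
  obtain ⟨M₃, hM₃, hcut₃⟩ := exists_cutoff (r := 6 / 8) (r' := 7 / 8) (by norm_num) (by norm_num)
  set M := max M₁ (max M₂ M₃) with hMdef
  have hM1 : M₁ ≤ M := le_max_left _ _
  have hM2 : M₂ ≤ M := (le_max_left _ _).trans (le_max_right _ _)
  have hM3 : M₃ ≤ M := (le_max_right _ _).trans (le_max_right _ _)
  have hM : 0 < M := by linarith
  -- `3072 = 384 * 8`: the localized energy may double to `2 * ε₀`, and gradient sums carry a
  -- further factor `4`.
  set ε₀ : ℝ := 1 / (3072 * K ^ 2) with hε₀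
  have hε₀pos : 0 < ε₀ := by positivity
  refine ⟨ε₀, hε₀pos, fun E hE => ?_⟩
  -- Up to time `δ * L ^ 2` the local energy gains at most `2 * (M / L) ^ 2 * (4 * E) * δ * L ^ 2 ≤
  -- ε₀`. The bound by `1` keeps the rescaled time below `M ^ 2`.
  set δ : ℝ := min 1 (ε₀ / (8 * M ^ 2 * (E + 1))) with hδ
  have hδ1 : δ ≤ 1 := min_le_left _ _
  have hδ2 : 8 * M ^ 2 * (E + 1) * δ ≤ ε₀ := by
    have : δ ≤ ε₀ / (8 * M ^ 2 * (E + 1)) := min_le_right _ _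
    rw [le_div_iff₀ (by positivity)] at this
    linarith
  have hδ0 : 0 < δ := lt_min one_pos (by positivity)
  refine ⟨δ, hδ0, fun θ hθ => ⟨max (100 ^ 2 * (201 ^ 2 * (256 * K ^ 2)))
    (smoothingConst K (9 * M ^ 2) (M ^ 2) / θ), fun u hu hE0 t₀ x L ht₀ hL hsmall t ht1 ht2 => ?_⟩⟩
  have hL2 : 0 < L ^ 2 := by positivity
  have hθL : 0 < θ * L ^ 2 := by positivity
  have ht : t₀ ≤ t := by linarith
  have hut : ∀ j, ‖u t j‖ ≤ K := fun j => hK.norm_le _ (hu.mem t (ht₀.trans ht) j)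
  -- On small discs compactness of `N` bounds everything. For large `L` the gaps between successive
  -- radii, at least `L / 16`, exceed the few lattice steps needed to nest the cutoffs.
  rcases lt_or_ge L 100 with hL100 | hL100
  · refine le_trans ?_ (le_max_left _ _)
    calc L ^ 2 * ∑ j ∈ latticeBall x (L / 8), hessSq (u t) j
        ≤ L ^ 2 * ∑ _j ∈ latticeBall x (L / 8), 256 * K ^ 2 := by
          gcongr; exact hessSq_le hut _
      _ = L ^ 2 * ((latticeBall x (L / 8)).card * (256 * K ^ 2)) := by
          rw [Finset.sum_const, nsmul_eq_mul]
      _ ≤ 100 ^ 2 * (201 ^ 2 * (256 * K ^ 2)) := by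
          gcongr
          refine (card_latticeBall_le x (by positivity)).trans ?_
          gcongr
          linarith
  refine le_trans ?_ (le_max_right _ _)
  obtain ⟨φ, hφ, hφ1, hφs⟩ := hcut₁ x L hL
  obtain ⟨ψ, hψ, hψ1, hψs⟩ := hcut₂ x L hL
  obtain ⟨χ, hχ, hχ1, -⟩ := hcut₃ x L hL
  set S := latticeBall x (11 / 16 * L) with hS
  have hφ := (hφ S fun j hj => by
    rw [mem_latticeBall] at hj ⊢; linarith).mono (by positivity) (div_le_div_of_nonneg_right hM1 hL.le)
  have hψ := (hψ S fun j hj => by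
    rw [mem_latticeBall] at hj ⊢; linarith).mono (by positivity) (div_le_div_of_nonneg_right hM2 hL.le)
  have hχ := (hχ (latticeBall x L) fun j hj => by
    rw [mem_latticeBall] at hj ⊢; linarith).mono (by positivity) (div_le_div_of_nonneg_right hM3 hL.le)
  have hφψ : ∀ j, φ j ≠ 0 → ψ j = 1 ∧ ∀ a, ψ (j + dir a) = 1 := fun j hj => by
    have h1 := hφs j hj
    refine ⟨hψ1 j (by linarith), fun a => hψ1 _ ?_⟩
    have h2 := norm_gridPoint_add_sub_le j (dir a) x
    have h3 := norm_gridPoint_dir_le a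
    linarith
  have hκ : 0 ≤ M / L := by positivity
  have hκL : (M / L) ^ 2 * L ^ 2 = M ^ 2 := by
    rw [← mul_pow, div_mul_cancel₀ _ hL.ne']
  have htime : ∀ s ∈ Set.Icc t₀ t, s - t₀ ≤ δ * L ^ 2 := fun s hs => by
    linarith [hs.2]
  have hB : (M / L) ^ 2 * S.card ≤ 9 * M ^ 2 := by
    calc (M / L) ^ 2 * S.card ≤ (M / L) ^ 2 * (2 * (11 / 16 * L) + 1) ^ 2 := by
          gcongr; exact card_latticeBall_le x (by positivity)
      _ ≤ (M / L) ^ 2 * (3 * L) ^ 2 := by gcongr; linarith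
      _ = 9 * ((M / L) ^ 2 * L ^ 2) := by ring
      _ = _ := by rw [hκL]
  have henergy : ∀ s ∈ Set.Icc t₀ t, cutoffEnergy (latticeBall x L) χ (u s) ≤ 2 * ε₀ :=
    fun s hs => by
    have h1 := hu.cutoffEnergy_le hK hχ hκ ht₀ hs.1 (A := 4 * E) fun r hr => by
      linarith [hu.sum_gradSq_le hK hE0 (ht₀.trans hr.1) (latticeBall x L)]
    have h2 := (hχ.cutoffEnergy_le (u t₀)).trans hsmall
    have h3 : 2 * (M / L) ^ 2 * (4 * E) * (s - t₀) ≤ ε₀ := by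
      calc 2 * (M / L) ^ 2 * (4 * E) * (s - t₀)
          ≤ 2 * (M / L) ^ 2 * (4 * (E + 1)) * (δ * L ^ 2) := by
            gcongr
            · exact sub_nonneg.2 hs.1
            · linarith
            · exact htime s hs
        _ = 8 * ((M / L) ^ 2 * L ^ 2) * (E + 1) * δ := by ring
        _ ≤ ε₀ := by rw [hκL]; exact hδ2
    linarith
  have hloc : ∀ s ∈ Set.Icc t₀ t, ∀ d : Grid, (∀ i, |d i| ≤ 1) →
      ∑ j ∈ S, gradSq (u s) (j + d) ≤ 8 * ε₀ := fun s hs d hd => by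
    have h1 := hχ.sum_gradSq_le_cutoffEnergy (u s) (T := S.map (addRightEmbedding d))
      fun j hj => by
        obtain ⟨k, hk, rfl⟩ := Finset.mem_map.1 hj
        rw [hS, mem_latticeBall] at hk
        have h2 := norm_gridPoint_add_sub_le k d x
        have h3 : ‖gridPoint 1 d‖ ≤ 3 / 2 * (1 : ℤ) := norm_gridPoint_one_le hd
        norm_num at h3
        rw [addRightEmbedding_apply]
        refine ⟨hχ1 _ (by linarith), fun a => hχ1 _ ?_⟩
        have h4 := norm_gridPoint_add_sub_le (k + d) (dir a) x
        have h5 := norm_gridPoint_dir_le a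
        linarith
    rw [Finset.sum_map] at h1
    simp only [addRightEmbedding_apply] at h1
    linarith [henergy s hs]
  have hεsmall : 384 * K ^ 2 * (8 * ε₀) ≤ 1 := by
    rw [hε₀]
    field_simp
    norm_num
  have key := hu.smoothing hK hν hφ hψ hφψ hκ hB hεsmall ht₀ ht (M := M ^ 2) (by
    calc (M / L) ^ 2 * (t - t₀) ≤ (M / L) ^ 2 * (1 * L ^ 2) := by
          gcongr
          exact (htime t ⟨ht, le_rfl⟩).trans (by gcongr)
      _ = M ^ 2 := by rw [one_mul, hκL]) hloc
  have hsum : ∑ j ∈ latticeBall x (L / 8), hessSq (u t) j ≤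
      ∑ j ∈ S, φ j ^ 2 * hessSq (u t) j := by
    have hsub : latticeBall x (L / 8) ⊆ S := fun j hj => by
      rw [hS]
      rw [mem_latticeBall] at hj ⊢; linarith
    refine le_trans (le_of_eq (Finset.sum_congr rfl fun j hj => ?_))
      (Finset.sum_le_sum_of_subset_of_nonneg hsub fun j _ _ =>
        mul_nonneg (sq_nonneg _) (hessSq_nonneg _ _))
    rw [mem_latticeBall] at hj
    rw [hφ1 j (by linarith)]
    ring
  rw [le_div_iff₀ hθ]
  calc (L ^ 2 * ∑ j ∈ latticeBall x (L / 8), hessSq (u t) j) * θ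
      = θ * L ^ 2 * ∑ j ∈ latticeBall x (L / 8), hessSq (u t) j := by ring
    _ ≤ (t - t₀) * ∑ j ∈ S, φ j ^ 2 * hessSq (u t) j := by
        gcongr
        · exact Finset.sum_nonneg fun _ _ => hessSq_nonneg _ _
        · linarith
    _ ≤ _ := key

end Flow

/-! ### Rescaling between grid size `h` and the unit lattice -/

section Rescaling

variable {h : ℝ}

theorem dPlus_eq (h : ℝ) (i : Fin 2) (v : Grid → Space) :
    dPlus h i v = h⁻¹ • del (Sum.inl i) v := rfl

theorem dMinus_eq (h : ℝ) (i : Fin 2) (v : Grid → Space) :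
    dMinus h i v = (-h⁻¹) • del (Sum.inr i) v := by
  funext j
  simp only [dMinus, Pi.smul_apply, del_apply, dir, Sum.elim_inr, ← sub_eq_add_neg]
  module

theorem laplacian_eq (h : ℝ) (v : Grid → Space) (j : Grid) :
    laplacian h v j = (h⁻¹) ^ 2 • lap v j := by
  simp only [laplacian, lap, Fintype.sum_sum_type, ← Finset.sum_add_distrib, Finset.smul_sum]
  refine Finset.sum_congr rfl fun i _ => ?_
  simp only [dPlus, dMinus, del_apply, dir, Sum.elim_inl, Sum.elim_inr, add_sub_cancel_right,
    ← sub_eq_add_neg]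
  module

/-- Parabolic rescaling to the unit lattice. -/
theorem IsDiscreteHeatFlow.isUnitFlow {N : Set Space} {ν : Space → Space}
    {u : ℝ → Grid → Space} (hu : IsDiscreteHeatFlow N ν h u) (hh : 0 < h) :
    IsUnitFlow N ν fun s => u (h ^ 2 * s) where
  mem t ht := hu.mem _ (by positivity)
  hasDeriv t ht j := by
    have h1 := hu.hasDeriv (h ^ 2 * t) (by positivity) j
    have h2 : HasDerivWithinAt (fun s => h ^ 2 * s) (h ^ 2 * 1) (Set.Ici 0) t :=
      (hasDerivWithinAt_id t _).const_mul (h ^ 2)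
    have h3 := h1.scomp t h2 fun s hs => mul_nonneg (sq_nonneg h) hs
    refine h3.congr_deriv ?_
    rw [tension, unitMultiplier, multiplier, laplacian_eq, inner_smul_left, mul_one, smul_add,
      smul_smul, smul_smul]
    simp only [conj_trivial]
    have : h ^ 2 * (h⁻¹) ^ 2 = 1 := by rw [← mul_pow, mul_inv_cancel₀ hh.ne', one_pow]
    rw [this, one_smul, mul_neg, ← mul_assoc, this, one_mul]

theorem gridPoint_mem_ball_iff (hh : 0 < h) (j : Grid) (x : Plane) (r : ℝ) :
    gridPoint h j ∈ Metric.ball x r ↔ j ∈ latticeBall (h⁻¹ • x) (r / h) := by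
  have h1 : gridPoint h j - x = h • (gridPoint 1 j - h⁻¹ • x) := by
    rw [smul_sub, smul_smul, mul_inv_cancel₀ hh.ne', one_smul]
    congr 1
    ext i
    simp [gridPoint, mul_comm]
  rw [mem_ball_iff_norm, mem_latticeBall, h1, norm_smul, Real.norm_of_nonneg hh.le,
    lt_div_iff₀ hh, mul_comm]

/-- Scale invariance in the plane: the area factor `h ^ 2` cancels the squared difference quotients,
leaving `1 / 2 * 1 / 2`. -/
theorem sum_gradSq_le_of_energyOn_le (hh : 0 < h) {A : Set Plane} {v : Grid → Space} {E : ℝ}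
    (hE0 : 0 ≤ E) (hE : energyOn h A v ≤ ENNReal.ofReal E) {T : Finset Grid}
    (hT : ∀ j ∈ T, gridPoint h j ∈ A) : 1 / 4 * ∑ j ∈ T, gradSq v j ≤ E := by
  have h1 : ∀ j, ∑ i, 1 / 2 * (‖dPlus h i v j‖ ^ 2 + ‖dMinus h i v j‖ ^ 2) =
      1 / 2 * (h⁻¹) ^ 2 * gradSq v j := fun j => by
    simp only [dPlus_eq, dMinus_eq, Pi.smul_apply, norm_smul, gradSq, Fintype.sum_sum_type,
      ← Finset.sum_add_distrib, Finset.mul_sum, norm_neg, norm_inv, mul_pow, inv_pow,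
      Real.norm_eq_abs, sq_abs]
    exact Finset.sum_congr rfl fun i _ => by ring
  rw [← ENNReal.ofReal_le_ofReal_iff hE0]
  refine le_trans ?_ hE
  simp only [energyOn, h1]
  rw [tsum_subtype (gridPoint h ⁻¹' A)
    fun j => ENNReal.ofReal (1 / 2 * h⁻¹ ^ 2 * gradSq v j)]
  refine le_trans (le_of_eq ?_) (mul_le_mul_right (ENNReal.sum_le_tsum T) _)
  rw [Finset.sum_congr rfl fun j hj => Set.indicator_of_mem (Set.mem_preimage.2 (hT j hj)) _,
    ← ENNReal.ofReal_sum_of_nonneg fun j _ => mul_nonneg (by positivity) (gradSq_nonneg v j),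
    ← ENNReal.ofReal_mul (by positivity), ← Finset.mul_sum]
  congr 1
  field_simp
  ring

theorem normL2_le_of_sum_le {V : Type*} [NormedAddCommGroup V] (hh : 0 < h) {A : Set Plane}
    {w : Grid → V} {C : ℝ} (hC : 0 ≤ C)
    (hw : ∀ T : Finset Grid, (∀ j ∈ T, gridPoint h j ∈ A) → h ^ 2 * ∑ j ∈ T, ‖w j‖ ^ 2 ≤ C ^ 2) :
    normL2 h A w ≤ ENNReal.ofReal C := by
  have h1 : ∑' j : (gridPoint h ⁻¹' A : Set Grid), ENNReal.ofReal (‖w j‖ ^ 2) ≤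
      ENNReal.ofReal (C ^ 2 / h ^ 2) := by
    rw [ENNReal.tsum_eq_iSup_sum]
    refine iSup_le fun T => ?_
    have hT := hw (T.map (Function.Embedding.subtype _)) fun j hj => by
      obtain ⟨k, -, rfl⟩ := Finset.mem_map.1 hj
      exact k.2
    rw [Finset.sum_map] at hT
    rw [← ENNReal.ofReal_sum_of_nonneg fun _ _ => sq_nonneg _]
    refine ENNReal.ofReal_le_ofReal ?_
    rw [le_div_iff₀ (by positivity), mul_comm]
    exact hT
  have h2 : ENNReal.ofReal (h ^ 2) * ∑' j : (gridPoint h ⁻¹' A : Set Grid),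
      ENNReal.ofReal (‖w j‖ ^ 2) ≤ ENNReal.ofReal (C ^ 2) := by
    refine (mul_le_mul_right h1 _).trans (le_of_eq ?_)
    rw [← ENNReal.ofReal_mul (by positivity), mul_div_cancel₀ _ (by positivity)]
  rw [normL2]
  refine (ENNReal.rpow_le_rpow h2 (by norm_num)).trans (le_of_eq ?_)
  rw [ENNReal.ofReal_rpow_of_nonneg (by positivity) (by norm_num), ← Real.sqrt_eq_rpow,
    Real.sqrt_sq hC]

/-- The difference quotient in a direction. -/
noncomputable def diffQuot (h : ℝ) : Dir → (Grid → Space) → Grid → Space :=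
  Sum.elim (dPlus h) (dMinus h)

theorem sq_norm_diffQuot_diffQuot_le (h : ℝ) (a b : Dir) (v : Grid → Space) (j : Grid) :
    ‖diffQuot h a (diffQuot h b v) j‖ ^ 2 ≤ (h⁻¹) ^ 4 * hessSq v j := by
  have h1 : ∀ a, ∃ c : ℝ, c ^ 2 = (h⁻¹) ^ 2 ∧ ∀ v, diffQuot h a v = c • del a v := fun a => by
    rcases a with i | i
    · exact ⟨h⁻¹, rfl, fun v => dPlus_eq h i v⟩
    · exact ⟨-h⁻¹, by ring, fun v => dMinus_eq h i v⟩
  obtain ⟨c, hc, hca⟩ := h1 a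
  obtain ⟨d, hd, hdb⟩ := h1 b
  have h2 : diffQuot h a (diffQuot h b v) j = (c * d) • del a (del b v) j := by
    rw [hca, hdb]
    simp only [Pi.smul_apply, del_apply]
    module
  have h3 : ‖del a (del b v) j‖ ^ 2 ≤ hessSq v j :=
    (Finset.single_le_sum (f := fun b => ‖del a (del b v) j‖ ^ 2) (fun _ _ => sq_nonneg _)
      (Finset.mem_univ b)).trans (Finset.single_le_sum
        (f := fun a => ∑ b, ‖del a (del b v) j‖ ^ 2)
        (fun _ _ => Finset.sum_nonneg fun _ _ => sq_nonneg _) (Finset.mem_univ a))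
  rw [h2, norm_smul, mul_pow, Real.norm_eq_abs, sq_abs, mul_pow, hc, hd, ← pow_add]
  exact mul_le_mul_of_nonneg_left h3 ((even_two.add even_two).pow_nonneg _)

theorem sq_norm_diffOp_le (h : ℝ) {α : Fin 2 ⊕ Fin 2 → ℕ} (hα : α ∈ multiIndices 2)
    (v : Grid → Space) (j : Grid) : ‖diffOp h α v j‖ ^ 2 ≤ (h⁻¹) ^ 4 * hessSq v j := by
  have key := fun a b => sq_norm_diffQuot_diffQuot_le h a b v j
  have hsum : α (Sum.inl 0) + α (Sum.inl 1) + (α (Sum.inr 0) + α (Sum.inr 1)) = 2 := by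
    have := (Finset.mem_piAntidiag.1 hα).1
    simpa [Fintype.sum_sum_type, Fin.sum_univ_two] using this
  rw [diffOp]
  generalize α (Sum.inl 0) = p at *
  generalize α (Sum.inl 1) = q at *
  generalize α (Sum.inr 0) = r at *
  generalize α (Sum.inr 1) = s at *
  have hp : p ≤ 2 := by omega
  have hq : q ≤ 2 := by omega
  have hr : r ≤ 2 := by omega
  obtain rfl : s = 2 - p - q - r := by omega
  -- Ten multi-indices of order two remain. Each `diffOp` is definitionally a composition of two
  -- difference quotients, in the fixed order of its four slots.
  interval_cases p <;> interval_cases q <;> interval_cases r <;>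
    first
    | omega
    | exact key (Sum.inl 0) (Sum.inl 0)
    | exact key (Sum.inl 0) (Sum.inr 0)
    | exact key (Sum.inl 0) (Sum.inl 1)
    | exact key (Sum.inl 0) (Sum.inr 1)
    | exact key (Sum.inr 0) (Sum.inr 0)
    | exact key (Sum.inr 0) (Sum.inl 1)
    | exact key (Sum.inr 0) (Sum.inr 1)
    | exact key (Sum.inl 1) (Sum.inl 1)
    | exact key (Sum.inl 1) (Sum.inr 1)
    | exact key (Sum.inr 1) (Sum.inr 1)

theorem sq_norm_diffVec_le (h : ℝ) (v : Grid → Space) (j : Grid) :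
    ‖diffVec h 2 v j‖ ^ 2 ≤ (multiIndices 2).card * ((h⁻¹) ^ 4 * hessSq v j) := by
  rw [PiLp.norm_sq_eq_of_L2]
  refine (Finset.sum_le_sum fun α _ => sq_norm_diffOp_le h α.2 v j).trans (le_of_eq ?_)
  simp

end Rescaling

end DiscreteFlow

/-! ### Transfer to the grid of size `h` -/

open DiscreteFlow
theorem mainTheorem6 (N : Set Space) (ν : Space → Space) (hN : IsCompact N)
    (hν : IsHypersurfaceWithNormal N ν) :
    ∃ ε₀ : ℝ, 0 < ε₀ ∧
      ∀ E₀ : ℝ≥0, ∃ δ : ℝ, 0 < δ ∧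
        ∀ R : ℝ, 0 < R → ∀ σ : ℝ, 0 < σ → σ ≤ δ * R ^ 2 →
          ∃ C : ℝ, ∀ (h : ℝ), 0 < h → ∀ u : ℝ → Grid → Space,
            IsDiscreteHeatFlow N ν h u → energy h (u 0) ≤ E₀ →
            ∀ (t₀ : ℝ) (x₀ : Plane), 0 ≤ t₀ →
              energyOn h (Metric.ball x₀ R) (u t₀) ≤ ENNReal.ofReal ε₀ →
              ∀ t ∈ Set.Icc (t₀ + σ) (t₀ + δ * R ^ 2),
                normL2 h (Metric.ball x₀ (R / 8)) (diffVec h 2 (u t)) ≤ ENNReal.ofReal C := by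
  obtain ⟨K, hK⟩ := hν.exists_geometryBound hN
  obtain ⟨ε₀, hε₀, H⟩ := exists_unit_regularity hK hν
  refine ⟨ε₀, hε₀, fun E₀ => ?_⟩
  obtain ⟨δ, hδ, H⟩ := H E₀ E₀.coe_nonneg
  refine ⟨δ, hδ, fun R hR σ hσ _ => ?_⟩
  -- The waiting time is made scale free: with `L = R / h`, the rescaled `σ / h ^ 2` equals `σ / R ^
  -- 2 * L ^ 2`.
  obtain ⟨C, H⟩ := H (σ / R ^ 2) (by positivity)
  let n : ℝ := ((multiIndices 2).card : ℕ)
  -- Second difference quotients scale as `h⁻¹ ^ 4` when squared, and the area factor leaves `1 / h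
  -- ^ 2 = L ^ 2 / R ^ 2`; the unit-lattice bound already contains `L ^ 2`. The maximum with `0` is
  -- taken because the sign of `C` is not recorded.
  refine ⟨√(n * max C 0 / R ^ 2), fun h hh u hu hE t₀ x₀ ht₀ hsmall t ht => ?_⟩
  have hpos : 0 ≤ n * max C 0 / R ^ 2 :=
    div_nonneg (mul_nonneg (Nat.cast_nonneg _) (le_max_right _ _)) (sq_nonneg _)
  have hback : ∀ s, h ^ 2 * (s / h ^ 2) = s := fun s => mul_div_cancel₀ s (by positivity)
  have hL : (R / h) ^ 2 = R ^ 2 / h ^ 2 := div_pow _ _ _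
  have key := H _ (hu.isUnitFlow hh) (fun T => by
      rw [mul_zero]
      refine sum_gradSq_le_of_energyOn_le hh E₀.coe_nonneg (A := Set.univ) ?_ fun _ _ => trivial
      rwa [ENNReal.ofReal_coe_nnreal])
    (t₀ / h ^ 2) (h⁻¹ • x₀) (R / h) (by positivity) (by positivity) (by
      rw [hback]
      exact sum_gradSq_le_of_energyOn_le hh hε₀.le hsmall fun j hj =>
        (gridPoint_mem_ball_iff hh j x₀ R).2 hj)
    (t / h ^ 2) (by
      rw [hL, div_mul_div_cancel₀ (by positivity), ← add_div]
      gcongr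
      exact ht.1) (by
      rw [hL, ← mul_div_assoc, ← add_div]
      gcongr
      exact ht.2)
  rw [hback, hL] at key
  refine normL2_le_of_sum_le hh (Real.sqrt_nonneg _) fun T hT => ?_
  rw [Real.sq_sqrt hpos]
  have hTsub : T ⊆ latticeBall (h⁻¹ • x₀) (R / h / 8) := fun j hj => by
    rw [div_right_comm]
    exact (gridPoint_mem_ball_iff hh j x₀ (R / 8)).1 (hT j hj)
  calc h ^ 2 * ∑ j ∈ T, ‖diffVec h 2 (u t) j‖ ^ 2
      ≤ h ^ 2 * ∑ j ∈ T, n * ((h⁻¹) ^ 4 * hessSq (u t) j) := by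
        gcongr; exact sq_norm_diffVec_le h _ _
    _ = n / R ^ 2 * (R ^ 2 / h ^ 2 * ∑ j ∈ T, hessSq (u t) j) := by
        rw [← Finset.mul_sum, ← Finset.mul_sum]
        field_simp
    _ ≤ n / R ^ 2 * (R ^ 2 / h ^ 2 *
          ∑ j ∈ latticeBall (h⁻¹ • x₀) (R / h / 8), hessSq (u t) j) := by
        gcongr
        exact fun j _ _ => hessSq_nonneg _ _
    _ ≤ n / R ^ 2 * max C 0 := by
        gcongr
        exact key.trans (le_max_left _ _)
    _ = _ := by ring
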